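/- **Setting.** Let $G$ be a Lie group and $N,H\le G$ closed subgroups with $N$ normal and abelian such that $N\times H\to G$, $(n,h)\mapsto nh$, is a diffeomorphism ($G=N\ltimes H$). Let $\nu\colon N\to\mathbb T$ be a (smooth) unitary character, $G_\nu=\{x\in G:\nu(x^{-1}nx)=\nu(n)\ \forall n\in N\}$, $H_\nu=H\cap G_\nu$, and give $H/H_\nu$ its quotient manifold structure. Let $\mathcal K_\Phi$ be a finite-dimensional complex Hilbert space, $\mathcal H_\sigma\le\mathcal K_\Phi$ a subspace with the inherited inner product $\langle\cdot,\cdot\rangle_\sigma$, $\sigma\colon H_\nu\to U(\mathcal H_\sigma)$ a unitary representation and $\Phi\colon H\to GL(\mathcal K_\Phi)$ a smooth representation that extends it, $\Phi(k)v=\sigma(k)v$ for $k\in H_\nu$, $v\in\mathcal H_\sigma$. Let $L\colon H/H_\nu\to H$ be a smooth global section of $H\to H/H_\nu$, put $W_L(h,q)=L(hq)^{-1}hL(q)\in H_\nu$, and let $\mu$ be an $H$-invariant Borel measure on $H/H_\nu$ that is finite on compact sets. A *Hermitian $G$-bundle* over a manifold $M$ with a smooth $G$-action $l$ is a smooth complex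 vector bundle $E\to M$ with a smooth Hermitian metric and a smooth $G$-action $\lambda$ on $E$ covering $l$ by fiberwise linear isometries; if $\mu$ is a $G$-invariant measure on $M$, its *associated induced representation* is $U(g)\psi=\lambda(g)\circ\psi\circ l_g^{-1}$ on the space $L^2(M,E;\mu)$ of square-integrable Borel sections modulo null sections. $\mathrm{Ind}_{G_\nu}^G\nu\sigma$ is left translation, $f\mapsto f(x^{-1}\,\cdot\,)$, on the Borel functions $f\colon G\to\mathcal H_\sigma$ with $f(gs)=(\nu\sigma)(s)^{-1}f(g)$ for $s\in G_\nu$ and $\int_{G/G_\nu}\|f\|^2d\mu<\infty$, modulo null functions, where $(\nu\sigma)(nk)=\nu(n)\sigma(k)$ for $n\in N$, $k\in H_\nu$ and $\mu$ is transported by $H/H_\nu\cong G/G_\nu$, $hH_\nu\mapsto hG_\nu$. $G$ acts on $H/H_\nu$ by $nh\cdot yH_\nu=hyH_\nu$. **Theorem.** The following are well-defined Hermitian $G$-bundles over $H/H_\nu$. * The boosting bundle $E_{L,\sigma}=H/H_\nu\times\mathcal H_\sigma$, with metric $h_L((q,v),(q,w))=\langle v,w\rangle_\sigma$ and action $\lambda_L(nh)(yH_\nu,v)=\bigl(hyH_\nu,\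 \nu((hy)^{-1}nhy)\,\sigma(W_L(h,yH_\nu))v\bigr)$. * The perception bundle $E_\sigma=R_\sigma$, the range of $A\colon H/H_\nu\times\mathcal H_\sigma\to H/H_\nu\times\mathcal K_\Phi$, $A(q,w)=(q,\Phi(L(q))w)$, a smooth subbundle of $H/H_\nu\times\mathcal K_\Phi$, with metric $h((xH_\nu,v),(xH_\nu,w))=\langle v,\Phi(x)^{\dagger-1}\Phi(x)^{-1}w\rangle$ (for every representative $x$) and action $\lambda(nh)(yH_\nu,v)=\bigl(hyH_\nu,\ \nu((hy)^{-1}nhy)\,\Phi(h)v\bigr)$. The map $A\colon E_{L,\sigma}\to E_\sigma$ is an isomorphism of Hermitian $G$-bundles. The associated induced representations $U$ of $E_\sigma$ and $U_L$ of $E_{L,\sigma}$, and $\mathrm{Ind}_{G_\nu}^G\nu\sigma$, are strongly continuous unitary representations on Hilbert spaces and $$\mathrm{Ind}_{G_\nu}^G\nu\sigma\cong U\cong U_L;$$ $\psi\mapsto A\circ\psi$ is a unitary operator from the space of $U_L$ onto that of $U$ which intertwines $U_L$ and $U$, and the space of $U_L$ is $L^2(H/H_\nu;\mu)\otimes\mathcal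 H_\sigma$, where $f\otimes v$ corresponds to the section $q\mapsto f(q)v$. -/

import Mathlib

open MeasureTheory Set Function
open scoped Manifold ContDiff TensorProduct ComplexConjugate

noncomputable section

namespace Perception

/-! ## Unitary representations -/

section UnitaryRep

variable {G 𝓗 𝓗' : Type*} [Group G]
  [NormedAddCommGroup 𝓗] [InnerProductSpace ℂ 𝓗] [NormedAddCommGroup 𝓗'] [InnerProductSpace ℂ 𝓗']

/-- A homomorphism into the unitary group is a unitary representation: the space is a Hilbert space
and the homomorphism is strongly continuous. -/
def IsUnitaryRepresentation [TopologicalSpace G] (ρ : G →* (𝓗 ≃ₗᵢ[ℂ] 𝓗)) : Prop :=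
  CompleteSpace 𝓗 ∧ ∀ v : 𝓗, Continuous fun g => ρ g v

/-- The unitary operator `T` intertwines the two representations. -/
def Intertwines (ρ : G →* (𝓗 ≃ₗᵢ[ℂ] 𝓗)) (ρ' : G →* (𝓗' ≃ₗᵢ[ℂ] 𝓗')) (T : 𝓗 ≃ₗᵢ[ℂ] 𝓗') : Prop :=
  ∀ (g : G) (v : 𝓗), T (ρ g v) = ρ' g (T v)

/-- Unitary equivalence of representations. -/
def UnitarilyEquivalent (ρ : G →* (𝓗 ≃ₗᵢ[ℂ] 𝓗)) (ρ' : G →* (𝓗' ≃ₗᵢ[ℂ] 𝓗')) : Prop :=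
  ∃ T : 𝓗 ≃ₗᵢ[ℂ] 𝓗', Intertwines ρ ρ' T

end UnitaryRep

/-! ## The `L²` space of a vector space of functions with a pointwise inner product

Both the Hilbert space of square-integrable Borel sections of an Hermitian bundle and the Hilbert
space of an induced representation are of the following form: there is a vector space `𝓑` of Borel
functions, and for each point `x` of a measure space `M` a positive semidefinite form on `𝓑` (the
inner product of the values at `x`). The Hilbert space is
`{f ∈ 𝓑 | ∫ ⟨f, f⟩_x dμ(x) < ∞}` modulo the functions with `∫ ⟨f, f⟩_x dμ(x) = 0`. -/

/-- A measurable family of positive semidefinite Hermitian forms, indexed by `M`, on `𝓑`. -/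
structure FormField (M : Type*) [MeasurableSpace M] (𝓑 : Type*) [AddCommGroup 𝓑] [Module ℂ 𝓑] where
  core : M → PreInnerProductSpace.Core ℂ 𝓑
  measurable_form : ∀ f g : 𝓑, Measurable fun x => (core x).inner f g

namespace FormField

variable {M : Type*} [MeasurableSpace M] {𝓑 : Type*} [AddCommGroup 𝓑] [Module ℂ 𝓑]
  (D : FormField M 𝓑) (μ : Measure M)

/-- The value of the form at `x`; conjugate linear in the first variable. -/
def form (x : M) (f g : 𝓑) : ℂ := (D.core x).inner f g

variable {D} in
theorem measurable_form' (f g : 𝓑) : Measurable fun x => D.form x f g := D.measurable_form f g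

theorem form_add_left (x : M) (f g k : 𝓑) :
    D.form x (f + g) k = D.form x f k + D.form x g k := (D.core x).add_left f g k

theorem form_smul_left (x : M) (c : ℂ) (f g : 𝓑) :
    D.form x (c • f) g = conj c * D.form x f g := (D.core x).smul_left f g c

theorem form_conj (x : M) (f g : 𝓑) : conj (D.form x g f) = D.form x f g :=
  (D.core x).conj_inner_symm f g

theorem form_nonneg (x : M) (f : 𝓑) : 0 ≤ (D.form x f f).re := (D.core x).re_inner_nonneg f

theorem form_add_right (x : M) (f g k : 𝓑) :
    D.form x f (g + k) = D.form x f g + D.form x f k := by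
  rw [← D.form_conj, form_add_left, map_add, D.form_conj, D.form_conj]

theorem form_smul_right (x : M) (c : ℂ) (f g : 𝓑) :
    D.form x f (c • g) = c * D.form x f g := by
  rw [← D.form_conj, form_smul_left, map_mul, D.form_conj, Complex.conj_conj]

theorem norm_form_le (x : M) (f g : 𝓑) :
    ‖D.form x f g‖ ≤ (D.form x f f).re + (D.form x g g).re := by
  have h := @InnerProductSpace.Core.inner_mul_inner_self_le ℂ 𝓑 _ _ _ (D.core x) f g
  change ‖D.form x f g‖ * ‖D.form x g f‖ ≤ (D.form x f f).re * (D.form x g g).re at h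
  have h' : ‖D.form x g f‖ = ‖D.form x f g‖ := by
    rw [← D.form_conj x f g, RCLike.norm_conj]
  rw [h'] at h
  have := D.form_nonneg x f
  have := D.form_nonneg x g
  nlinarith [norm_nonneg (D.form x f g)]

/-- The condition `∫ ⟨f, f⟩_x dμ(x) < ∞`. -/
def SqIntegrable (f : 𝓑) : Prop := ∫⁻ x, ENNReal.ofReal (D.form x f f).re ∂μ < ⊤

variable {D μ} in
theorem SqIntegrable.integrable_re {f : 𝓑} (hf : D.SqIntegrable μ f) :
    Integrable (fun x => (D.form x f f).re) μ := by
  refine ⟨(Complex.measurable_re.comp (measurable_form' f f)).aestronglyMeasurable, ?_⟩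
  rw [hasFiniteIntegral_iff_ofReal (Filter.Eventually.of_forall fun x => D.form_nonneg x f)]
  exact hf

variable {D μ} in
theorem SqIntegrable.integrable {f g : 𝓑} (hf : D.SqIntegrable μ f) (hg : D.SqIntegrable μ g) :
    Integrable (fun x => D.form x f g) μ :=
  (hf.integrable_re.add hg.integrable_re).mono' (measurable_form' f g).aestronglyMeasurable
    (Filter.Eventually.of_forall fun x => D.norm_form_le x f g)

theorem sqIntegrable_of_integrable {f : 𝓑} (h : Integrable (fun x => D.form x f f) μ) :
    D.SqIntegrable μ f := by
  have h1 : HasFiniteIntegral (fun x => (D.form x f f).re) μ := h.re.2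
  rw [hasFiniteIntegral_iff_ofReal (Filter.Eventually.of_forall fun x => D.form_nonneg x f)] at h1
  exact h1

/-- The subspace of square-integrable elements. -/
def sqIntegrable : Submodule ℂ 𝓑 where
  carrier := {f | D.SqIntegrable μ f}
  zero_mem' := by
    have : ∀ x, D.form x 0 0 = 0 := fun x => by
      simpa using D.form_smul_left x 0 0 0
    simp [SqIntegrable, this]
  add_mem' {f g} hf hg := by
    apply D.sqIntegrable_of_integrable μ
    have : (fun x => D.form x (f + g) (f + g)) = fun x =>
        (D.form x f f + D.form x f g) + (D.form x g f + D.form x g g) := by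
      funext x
      rw [form_add_left, form_add_right, form_add_right]
    rw [this]
    exact ((SqIntegrable.integrable hf hf).add (SqIntegrable.integrable hf hg)).add
      ((SqIntegrable.integrable hg hf).add (SqIntegrable.integrable hg hg))
  smul_mem' c f hf := by
    apply D.sqIntegrable_of_integrable μ
    have : (fun x => D.form x (c • f) (c • f)) = fun x => conj c * (c * D.form x f f) := by
      funext x
      rw [form_smul_left, form_smul_right]
    rw [this]
    exact ((SqIntegrable.integrable hf hf).const_mul c).const_mul _

/-- The square-integrable elements, as a type that carries the seminorm of the `L²` form. -/
def PreL2 : Type _ := ↥(D.sqIntegrable μ)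

instance : AddCommGroup (D.PreL2 μ) := inferInstanceAs (AddCommGroup ↥(D.sqIntegrable μ))
instance : Module ℂ (D.PreL2 μ) := inferInstanceAs (Module ℂ ↥(D.sqIntegrable μ))

variable {D μ} in
/-- The underlying element of `𝓑`. -/
def PreL2.val (f : D.PreL2 μ) : 𝓑 := Subtype.val f

variable {D μ} in
theorem PreL2.property (f : D.PreL2 μ) : D.SqIntegrable μ f.val := Subtype.property f

variable {D μ} in
@[ext] theorem PreL2.ext {f g : D.PreL2 μ} (h : f.val = g.val) : f = g := Subtype.ext h

/-- The `L²` form `⟨f, g⟩ = ∫ ⟨f, g⟩_x dμ(x)`. -/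
@[reducible]
def preL2Core : PreInnerProductSpace.Core ℂ (D.PreL2 μ) where
  inner f g := ∫ x, D.form x f.val g.val ∂μ
  conj_inner_symm f g := by
    rw [← integral_conj]
    simp only [D.form_conj]
  re_inner_nonneg f := by
    have h := f.property.integrable f.property
    rw [show RCLike.re (∫ x, D.form x f.val f.val ∂μ) = ∫ x, (D.form x f.val f.val).re ∂μ from
      (integral_re h).symm]
    exact integral_nonneg fun x => D.form_nonneg x _
  add_left f g k := by
    rw [← integral_add (f.property.integrable k.property) (g.property.integrable k.property)]
    exact integral_congr_ae (Filter.Eventually.of_forall fun x => D.form_add_left x _ _ _)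
  smul_left f g c := by
    rw [← integral_const_mul]
    exact integral_congr_ae (Filter.Eventually.of_forall fun x => D.form_smul_left x _ _ _)

instance : SeminormedAddCommGroup (D.PreL2 μ) :=
  @InnerProductSpace.Core.toSeminormedAddCommGroup ℂ _ _ _ _ (D.preL2Core μ)

instance : InnerProductSpace ℂ (D.PreL2 μ) := InnerProductSpace.ofCore (D.preL2Core μ)

theorem PreL2.inner_def (f g : D.PreL2 μ) : inner ℂ f g = ∫ x, D.form x f.val g.val ∂μ := rfl

/-- The `L²` space: `PreL2` modulo the elements of seminorm zero. -/
abbrev L2 : Type _ := SeparationQuotient (D.PreL2 μ)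

section Action

variable {G : Type*} [Group G] (ρ : G →* Module.End ℂ 𝓑) (l : G →* Equiv.Perm M)

variable {D μ ρ l} in
theorem form_translate (h : ∀ g x f f', D.form (l g x) (ρ g f) (ρ g f') = D.form x f f')
    (g : G) (x : M) (f f' : 𝓑) :
    D.form x (ρ g f) (ρ g f') = D.form (l g⁻¹ x) f f' := by
  rw [← h g (l g⁻¹ x)]
  simp

variable {D μ ρ l} in
theorem integral_translate (hl : ∀ g, MeasurePreserving (l g) μ μ)
    (h : ∀ g x f f', D.form (l g x) (ρ g f) (ρ g f') = D.form x f f') (g : G) (f f' : 𝓑) :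
    ∫ x, D.form x (ρ g f) (ρ g f') ∂μ = ∫ x, D.form x f f' ∂μ := by
  simp only [form_translate h]
  conv_rhs => rw [← (hl g⁻¹).map_eq]
  rw [integral_map (hl g⁻¹).measurable.aemeasurable (measurable_form' f f').aestronglyMeasurable]

variable {D μ ρ l} in
theorem SqIntegrable.translate (hl : ∀ g, MeasurePreserving (l g) μ μ)
    (h : ∀ g x f f', D.form (l g x) (ρ g f) (ρ g f') = D.form x f f') (g : G) {f : 𝓑}
    (hf : D.SqIntegrable μ f) : D.SqIntegrable μ (ρ g f) := by
  unfold SqIntegrable at *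
  simp only [form_translate h]
  rw [← (hl g⁻¹).map_eq, lintegral_map _ (hl g⁻¹).measurable] at hf
  · exact hf
  · exact (Complex.measurable_re.comp (measurable_form' f f)).ennreal_ofReal

variable {D μ ρ l} in
/-- The operator of translation by `g` on `PreL2`. -/
def preTranslate (hl : ∀ g, MeasurePreserving (l g) μ μ)
    (h : ∀ g x f f', D.form (l g x) (ρ g f) (ρ g f') = D.form x f f') (g : G) :
    D.PreL2 μ →ₗᵢ[ℂ] D.PreL2 μ where
  toFun f := ⟨ρ g f.val, f.property.translate hl h g⟩
  map_add' f f' := PreL2.ext ((ρ g).map_add f.val f'.val)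
  map_smul' c f := PreL2.ext ((ρ g).map_smul c f.val)
  norm_map' f := by
    rw [@norm_eq_sqrt_re_inner ℂ, @norm_eq_sqrt_re_inner ℂ _ _ _ _ f]
    congr 2
    exact integral_translate hl h g f.val f.val

variable {D μ ρ l} in
/-- The operator of translation by `g` on `L2`. -/
def translate (hl : ∀ g, MeasurePreserving (l g) μ μ)
    (h : ∀ g x f f', D.form (l g x) (ρ g f) (ρ g f') = D.form x f f') (g : G) :
    D.L2 μ →ₗ[ℂ] D.L2 μ where
  toFun := SeparationQuotient.lift (fun f => SeparationQuotient.mk (preTranslate hl h g f))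
    fun _ _ hff' => SeparationQuotient.mk_eq_mk.2 (hff'.map (preTranslate hl h g).continuous)
  map_add' := by
    rintro ⟨f⟩ ⟨f'⟩
    exact congrArg SeparationQuotient.mk ((preTranslate hl h g).map_add f f')
  map_smul' c := by
    rintro ⟨f⟩
    exact congrArg SeparationQuotient.mk ((preTranslate hl h g).map_smul c f)

variable {D μ ρ l} in
/-- The unitary representation of `G` on `L2` that comes from an action `ρ` of `G` on `𝓑` by
operators which preserve the forms and cover a measure-preserving action `l` on `M`. -/
def unitaryRep (hl : ∀ g, MeasurePreserving (l g) μ μ)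
    (h : ∀ g x f f', D.form (l g x) (ρ g f) (ρ g f') = D.form x f f') :
    G →* (D.L2 μ ≃ₗᵢ[ℂ] D.L2 μ) :=
  have key : ∀ (g g' : G) (f : D.L2 μ),
      translate hl h (g * g') f = translate hl h g (translate hl h g' f) := by
    rintro g g' ⟨f⟩
    exact congrArg SeparationQuotient.mk (PreL2.ext (by
      change ρ (g * g') f.val = ρ g (ρ g' f.val)
      simp))
  have key1 : ∀ f : D.L2 μ, translate hl h 1 f = f := by
    rintro ⟨f⟩
    exact congrArg SeparationQuotient.mk (PreL2.ext (by
      change ρ 1 f.val = f.val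
      simp))
  { toFun := fun g =>
      { toLinearEquiv := LinearEquiv.ofLinearMap (translate hl h g) (translate hl h g⁻¹)
          (by ext f; simp [← key, key1]) (by ext f; simp [← key, key1])
        norm_map' := by
          rintro ⟨f⟩
          exact (preTranslate hl h g).norm_map f }
    map_one' := by
      ext f
      exact key1 f
    map_mul' := fun g g' => by
      ext f
      exact key g g' f }

end Action

end FormField

/-! ## Induced representations -/

section Induced

variable {G : Type*} [Group G] [MeasurableSpace G] (S : Subgroup G)
  {V : Type*} [NormedAddCommGroup V] [InnerProductSpace ℂ V] [FiniteDimensional ℂ V]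
  [MeasurableSpace V] [BorelSpace V] (σ : S →* (V ≃ₗᵢ[ℂ] V))

theorem secondCountable_of_finiteDimensional (V : Type*) [NormedAddCommGroup V] [NormedSpace ℂ V]
    [FiniteDimensional ℂ V] : SecondCountableTopology V :=
  haveI := FiniteDimensional.proper ℂ V
  inferInstance

/-- The Borel functions `f : G → V` with `f (g s) = σ(s)⁻¹ f(g)`. -/
def equivariantFunctions : Submodule ℂ (G → V) where
  carrier := {f | Measurable f ∧ ∀ (g : G) (s : S), f (g * s) = (σ s)⁻¹ (f g)}
  zero_mem' := ⟨measurable_const, fun g s => by simp⟩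
  add_mem' {f f'} hf hf' := by
    have := secondCountable_of_finiteDimensional V
    exact ⟨hf.1.add hf'.1, fun g s => by simp [hf.2, hf'.2]⟩
  smul_mem' c f hf := ⟨hf.1.const_smul c, fun g s => by simp [hf.2]⟩

theorem inner_equivariant (f f' : equivariantFunctions S σ) (g : G) (s : S) :
    inner ℂ (f.1 (g * s)) (f'.1 (g * s)) = inner ℂ (f.1 g) (f'.1 g) := by
  rw [f.2.2, f'.2.2, LinearIsometryEquiv.inner_map_map]

theorem inner_out (f f' : equivariantFunctions S σ) (g : G) :
    inner ℂ (f.1 (g : G ⧸ S).out) (f'.1 (g : G ⧸ S).out) = inner ℂ (f.1 g) (f'.1 g) := by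
  obtain ⟨s, hs⟩ := QuotientGroup.mk_out_eq_mul S g
  rw [hs, inner_equivariant]

/-- At `gS ∈ G/S`, the form `⟨f(g), f'(g)⟩`, which is independent of the representative `g`. -/
def inducedField : FormField (G ⧸ S) (equivariantFunctions S σ) where
  core q :=
    { inner := fun f f' => inner ℂ (f.1 q.out) (f'.1 q.out)
      conj_inner_symm := fun f f' => inner_conj_symm _ _
      re_inner_nonneg := fun f => inner_self_nonneg
      add_left := fun f f' k => inner_add_left _ _ _
      smul_left := fun f f' c => inner_smul_left _ _ _ }
  measurable_form f f' := by
    have := secondCountable_of_finiteDimensional V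
    refine QuotientGroup.measurable_from_quotient.2 ?_
    have : ((fun q : G ⧸ S => inner ℂ (f.1 q.out) (f'.1 q.out)) ∘ ((↑) : G → G ⧸ S)) =
        fun g => inner ℂ (f.1 g) (f'.1 g) := funext fun g => inner_out S σ f f' g
    exact this ▸ f.2.1.inner f'.2.1

theorem inducedField_form_mk (f f' : equivariantFunctions S σ) (g : G) :
    (inducedField S σ).form (g : G ⧸ S) f f' = inner ℂ (f.1 g) (f'.1 g) := inner_out S σ f f' g

variable [MeasurableMul G]

/-- Left translation `(x · f)(y) = f(x⁻¹ y)`. -/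
def leftTranslation : G →* Module.End ℂ (equivariantFunctions S σ) where
  toFun x :=
    { toFun := fun f => ⟨fun y => f.1 (x⁻¹ * y), f.2.1.comp (measurable_const_mul _),
        fun g s => by
          change f.1 (x⁻¹ * (g * s)) = _
          rw [← mul_assoc]
          exact f.2.2 _ s⟩
      map_add' := fun f f' => rfl
      map_smul' := fun c f => rfl }
  map_one' := by ext f y; simp
  map_mul' x x' := by ext f y; simp [mul_assoc]

theorem leftTranslation_form (g : G) (q : G ⧸ S) (f f' : equivariantFunctions S σ) :
    (inducedField S σ).form (MulAction.toPermHom G (G ⧸ S) g q)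
      (leftTranslation S σ g f) (leftTranslation S σ g f') = (inducedField S σ).form q f f' := by
  obtain ⟨y, rfl⟩ := QuotientGroup.mk_surjective q
  change (inducedField S σ).form ((g * y : G) : G ⧸ S) _ _ = _
  rw [inducedField_form_mk, inducedField_form_mk]
  simp [leftTranslation]

/-- The representation `Ind_S^G σ`, with respect to a `G`-invariant measure on `G/S`. -/
def Ind (μ : Measure (G ⧸ S)) (hμ : ∀ g, MeasurePreserving (MulAction.toPermHom G (G ⧸ S) g) μ μ) :
    G →* ((inducedField S σ).L2 μ ≃ₗᵢ[ℂ] (inducedField S σ).L2 μ) :=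
  FormField.unitaryRep hμ (leftTranslation_form S σ)

end Induced

/-! ## Hermitian `G`-bundles -/

section Bundle

/-- The family `F` of subspaces of `K` is a smooth subbundle of rank `r` of the product bundle
`M × K`: near each point there is a smooth local frame of `r` sections. -/
def IsSmoothSubbundle (EM : Type*) {M K : Type*} [NormedAddCommGroup EM] [NormedSpace ℝ EM]
    [TopologicalSpace M] [ChartedSpace EM M] [NormedAddCommGroup K] [NormedSpace ℂ K]
    (r : ℕ) (F : M → Submodule ℂ K) : Prop :=
  ∀ x₀ : M, ∃ U : Set M, IsOpen U ∧ x₀ ∈ U ∧ ∃ s : Fin r → M → K,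
    (∀ i, ContMDiffOn 𝓘(ℝ, EM) 𝓘(ℝ, K) ∞ (s i) U) ∧
    ∀ x ∈ U, LinearIndependent ℂ (fun i => s i x) ∧ Submodule.span ℂ (range fun i => s i x) = F x

/-- The total space `{(x, v) | v ∈ F x}`. -/
def totalSpace {M K : Type*} [NormedAddCommGroup K] [NormedSpace ℂ K] (F : M → Submodule ℂ K) :
    Set (M × K) :=
  {p | p.2 ∈ F p.1}

/-- An Hermitian `G`-bundle over the manifold `M`, on which the Lie group `G` acts by `l`, whose
underlying vector bundle is a smooth subbundle of a product bundle `M × K`. The metric and the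
action are given by functions on all of `K` and `M × K`, of which only the restrictions to the
fibers and to the total space matter. The metric is conjugate linear in the first variable.
Smoothness on the total space, an embedded submanifold of `M × K`, is smoothness on this subset. -/
structure HermitianGBundle (EG EM : Type*) {G M : Type*} [Group G] [TopologicalSpace G]
    [NormedAddCommGroup EG] [NormedSpace ℝ EG] [ChartedSpace EG G]
    [TopologicalSpace M] [NormedAddCommGroup EM] [NormedSpace ℝ EM] [ChartedSpace EM M]
    (l : G →* Equiv.Perm M) (K : Type*) [NormedAddCommGroup K] [NormedSpace ℂ K] where
  rank : ℕ
  fiber : M → Submodule ℂ K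
  isSubbundle : IsSmoothSubbundle EM rank fiber
  metric : M → K → K → ℂ
  metric_add_left : ∀ x, ∀ u ∈ fiber x, ∀ v ∈ fiber x, ∀ w ∈ fiber x,
    metric x (u + v) w = metric x u w + metric x v w
  metric_smul_left : ∀ x, ∀ c : ℂ, ∀ u ∈ fiber x, ∀ v ∈ fiber x,
    metric x (c • u) v = conj c * metric x u v
  metric_conj : ∀ x, ∀ u ∈ fiber x, ∀ v ∈ fiber x, conj (metric x v u) = metric x u v
  metric_pos : ∀ x, ∀ u ∈ fiber x, u ≠ 0 → 0 < (metric x u u).re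
  smooth_metric : ContMDiffOn (𝓘(ℝ, EM).prod (𝓘(ℝ, K).prod 𝓘(ℝ, K))) 𝓘(ℝ, ℂ) ∞
    (fun p : M × (K × K) => metric p.1 p.2.1 p.2.2)
    {p | p.2.1 ∈ fiber p.1 ∧ p.2.2 ∈ fiber p.1}
  smooth_base : ContMDiff (𝓘(ℝ, EG).prod 𝓘(ℝ, EM)) 𝓘(ℝ, EM) ∞ fun q : G × M => l q.1 q.2
  act : G → M × K → M × K
  act_fst : ∀ g, ∀ p ∈ totalSpace fiber, (act g p).1 = l g p.1
  act_mem : ∀ g, ∀ p ∈ totalSpace fiber, act g p ∈ totalSpace fiber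
  act_one : ∀ p ∈ totalSpace fiber, act 1 p = p
  act_mul : ∀ g g', ∀ p ∈ totalSpace fiber, act (g * g') p = act g (act g' p)
  act_add : ∀ g x, ∀ u ∈ fiber x, ∀ v ∈ fiber x,
    (act g (x, u + v)).2 = (act g (x, u)).2 + (act g (x, v)).2
  act_smul : ∀ g x, ∀ c : ℂ, ∀ u ∈ fiber x, (act g (x, c • u)).2 = c • (act g (x, u)).2
  act_isometry : ∀ g x, ∀ u ∈ fiber x, ∀ v ∈ fiber x,
    metric (l g x) (act g (x, u)).2 (act g (x, v)).2 = metric x u v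
  smooth_act : ContMDiffOn (𝓘(ℝ, EG).prod (𝓘(ℝ, EM).prod 𝓘(ℝ, K))) (𝓘(ℝ, EM).prod 𝓘(ℝ, K)) ∞
    (fun q : G × (M × K) => act q.1 q.2) (univ ×ˢ totalSpace fiber)

namespace HermitianGBundle

variable {EG EM : Type*} {G M : Type*} [Group G] [TopologicalSpace G]
    [NormedAddCommGroup EG] [NormedSpace ℝ EG] [ChartedSpace EG G]
    [TopologicalSpace M] [NormedAddCommGroup EM] [NormedSpace ℝ EM] [ChartedSpace EM M]
    {l : G →* Equiv.Perm M}
    {K : Type*} [NormedAddCommGroup K] [NormedSpace ℂ K]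
    {K' : Type*} [NormedAddCommGroup K'] [NormedSpace ℂ K']

/-- The total space of the bundle. -/
def total (E : HermitianGBundle EG EM l K) : Set (M × K) := totalSpace E.fiber

/-- `A` restricts to an Hermitian `G`-bundle homomorphism over `M`: a smooth map of total spaces
over the identity of `M` that is linear and isometric on the fibers and `G`-equivariant. -/
structure IsHom (E : HermitianGBundle EG EM l K) (E' : HermitianGBundle EG EM l K')
    (A : M × K → M × K') : Prop where
  mapsTo : MapsTo A E.total E'.total
  map_base : ∀ p ∈ E.total, (A p).1 = p.1
  map_add : ∀ x, ∀ u ∈ E.fiber x, ∀ v ∈ E.fiber x,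
    (A (x, u + v)).2 = (A (x, u)).2 + (A (x, v)).2
  map_smul : ∀ x, ∀ c : ℂ, ∀ u ∈ E.fiber x, (A (x, c • u)).2 = c • (A (x, u)).2
  isometry : ∀ x, ∀ u ∈ E.fiber x, ∀ v ∈ E.fiber x,
    E'.metric x (A (x, u)).2 (A (x, v)).2 = E.metric x u v
  equivariant : ∀ g, ∀ p ∈ E.total, A (E.act g p) = E'.act g (A p)
  smooth : ContMDiffOn (𝓘(ℝ, EM).prod 𝓘(ℝ, K)) (𝓘(ℝ, EM).prod 𝓘(ℝ, K')) ∞ A E.total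

/-- `A` restricts to an Hermitian `G`-bundle isomorphism. -/
def IsIso (E : HermitianGBundle EG EM l K) (E' : HermitianGBundle EG EM l K')
    (A : M × K → M × K') : Prop :=
  E.IsHom E' A ∧ ∃ B : M × K' → M × K, E'.IsHom E B ∧ InvOn B A E.total E'.total

/-! ### Square-integrable sections -/

variable [FiniteDimensional ℂ K] [MeasurableSpace K] [BorelSpace K]
  [MeasurableSpace M] [OpensMeasurableSpace M]

/-- The space of Borel sections. -/
def borelSections (E : HermitianGBundle EG EM l K) : Submodule ℂ (M → K) where
  carrier := {ψ | Measurable ψ ∧ ∀ x, ψ x ∈ E.fiber x}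
  zero_mem' := ⟨measurable_const, fun x => zero_mem _⟩
  add_mem' {f f'} hf hf' := by
    have := secondCountable_of_finiteDimensional K
    exact ⟨hf.1.add hf'.1, fun x => add_mem (hf.2 x) (hf'.2 x)⟩
  smul_mem' c f hf := ⟨hf.1.const_smul c, fun x => Submodule.smul_mem _ c (hf.2 x)⟩

theorem measurable_comp_of_continuousOn {X Y Z : Type*} [MeasurableSpace X]
    [TopologicalSpace Y] [MeasurableSpace Y] [OpensMeasurableSpace Y]
    [TopologicalSpace Z] [MeasurableSpace Z] [BorelSpace Z] {f : Y → Z} {s : Set Y}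
    (hf : ContinuousOn f s) {g : X → Y} (hg : Measurable g) (hgs : ∀ x, g x ∈ s) :
    Measurable fun x => f (g x) :=
  (continuousOn_iff_continuous_domRestrict.1 hf).measurable.comp (hg.subtype_mk (h := hgs))

/-- The form field of an Hermitian bundle, `h_x(ψ(x), φ(x))`. -/
def formField (E : HermitianGBundle EG EM l K) : FormField M E.borelSections where
  core x :=
    { inner := fun ψ φ => E.metric x (ψ.1 x) (φ.1 x)
      conj_inner_symm := fun ψ φ => E.metric_conj x _ (ψ.2.2 x) _ (φ.2.2 x)
      re_inner_nonneg := fun ψ => by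
        change 0 ≤ (E.metric x (ψ.1 x) (ψ.1 x)).re
        by_cases h : ψ.1 x = 0
        · have := E.metric_smul_left x 0 0 (zero_mem _) 0 (zero_mem _)
          simp only [smul_zero, map_zero, zero_mul] at this
          rw [h, this]
          simp
        · exact (E.metric_pos x _ (ψ.2.2 x) h).le
      add_left := fun ψ φ χ => E.metric_add_left x _ (ψ.2.2 x) _ (φ.2.2 x) _ (χ.2.2 x)
      smul_left := fun ψ φ c => E.metric_smul_left x c _ (ψ.2.2 x) _ (φ.2.2 x) }
  measurable_form ψ φ := by
    have := secondCountable_of_finiteDimensional K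
    exact measurable_comp_of_continuousOn E.smooth_metric.continuousOn
      (measurable_id.prodMk (ψ.2.1.prodMk φ.2.1)) fun x => ⟨ψ.2.2 x, φ.2.2 x⟩

/-- The square-integrable Borel sections. -/
abbrev PreL2 (E : HermitianGBundle EG EM l K) (μ : Measure M) : Type _ := E.formField.PreL2 μ

/-- The Hilbert space `L²(M, E; μ, h)`. -/
abbrev L2 (E : HermitianGBundle EG EM l K) (μ : Measure M) : Type _ := E.formField.L2 μ

/-- The section underlying a square-integrable section. -/
def sec {E : HermitianGBundle EG EM l K} {μ : Measure M} (ψ : E.PreL2 μ) : M → K := ψ.val.1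

/-- The class of a square-integrable section. -/
def cls {E : HermitianGBundle EG EM l K} {μ : Measure M} (ψ : E.PreL2 μ) : E.L2 μ :=
  SeparationQuotient.mk ψ

/-- The operator `ψ ↦ λ(g) ∘ ψ ∘ (l_g)⁻¹` on Borel sections. -/
def sectionAction (E : HermitianGBundle EG EM l K) (hl : ∀ g, Measurable (l g)) :
    G →* Module.End ℂ E.borelSections where
  toFun g :=
    { toFun := fun ψ => ⟨fun x => (E.act g (l g⁻¹ x, ψ.1 (l g⁻¹ x))).2, by
        have := secondCountable_of_finiteDimensional K
        have hc : ContinuousOn (fun p => (E.act g p).2) (totalSpace E.fiber) := by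
          have h1 : ContinuousOn (fun p : M × K => ((g, p) : G × (M × K))) (totalSpace E.fiber) :=
            (continuous_const.prodMk continuous_id).continuousOn
          exact continuous_snd.comp_continuousOn
            (E.smooth_act.continuousOn.comp h1 fun p hp => ⟨mem_univ _, hp⟩)
        exact measurable_comp_of_continuousOn hc
          ((hl g⁻¹).prodMk (ψ.2.1.comp (hl g⁻¹))) fun x => ψ.2.2 _, fun x => by
        have hp : ((l g⁻¹ x, ψ.1 (l g⁻¹ x)) : M × K) ∈ totalSpace E.fiber := ψ.2.2 _
        have h1 := E.act_mem g _ hp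
        have h2 := E.act_fst g _ hp
        have h3 : l g (l g⁻¹ x) = x := by simp
        simp only [h3] at h2
        simpa only [totalSpace, mem_ofPred_eq, h2] using h1⟩
      map_add' := fun ψ φ => Subtype.ext (funext fun x =>
        E.act_add g _ _ (ψ.2.2 _) _ (φ.2.2 _))
      map_smul' := fun c ψ => Subtype.ext (funext fun x => E.act_smul g _ c _ (ψ.2.2 _)) }
  map_one' := by
    ext ψ x
    have := E.act_one (x, ψ.1 x) (ψ.2.2 x)
    simp [this]
  map_mul' g g' := by
    ext ψ x
    have hp : ((l g'⁻¹ (l g⁻¹ x), ψ.1 (l g'⁻¹ (l g⁻¹ x))) : M × K) ∈ totalSpace E.fiber := ψ.2.2 _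
    have h2 := E.act_fst g' _ hp
    have h3 : l g' (l g'⁻¹ (l g⁻¹ x)) = l g⁻¹ x := by simp
    simp only [h3] at h2
    simp only [mul_inv_rev, map_mul, Equiv.Perm.coe_mul, Function.comp_apply, Module.End.mul_apply,
      LinearMap.coe_mk, AddHom.coe_mk]
    rw [E.act_mul g g' _ hp]
    congr 2
    exact Prod.ext h2 rfl

/-- The induced representation associated with an Hermitian `G`-bundle and a `G`-invariant measure
on its base, `U(g) ψ = λ(g) ∘ ψ ∘ (l_g)⁻¹`. -/
def inducedRep (E : HermitianGBundle EG EM l K) (μ : Measure M)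
    (hμ : ∀ g, MeasurePreserving (l g) μ μ) : G →* (E.L2 μ ≃ₗᵢ[ℂ] E.L2 μ) :=
  FormField.unitaryRep (ρ := E.sectionAction fun g => (hμ g).measurable) hμ fun g x ψ φ => by
    change E.metric (l g x) (E.act g (l g⁻¹ (l g x), ψ.1 (l g⁻¹ (l g x)))).2
      (E.act g (l g⁻¹ (l g x), φ.1 (l g⁻¹ (l g x)))).2 = E.metric x (ψ.1 x) (φ.1 x)
    have h3 : l g⁻¹ (l g x) = x := by simp
    rw [h3]
    exact E.act_isometry g x _ (ψ.2.2 x) _ (φ.2.2 x)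

end HermitianGBundle

end Bundle

/-! ## Semidirect products -/

section Semidirect

variable {G : Type*} [Group G]

theorem semidirect_eq {N H : Subgroup G} (e : N × H ≃ G) (he : ∀ n h, e (n, h) = (n : G) * h) (g : G) : g = ((e.symm g).1 : G) * (e.symm g).2 := by
  rw [← he, e.apply_symm_apply]

theorem symm_mul {N H : Subgroup G} (e : N × H ≃ G) (he : ∀ n h, e (n, h) = (n : G) * h)
    (n : N) (h : H) : e.symm ((n : G) * h) = (n, h) := by
  rw [← he, e.symm_apply_apply]

variable (N H : Subgroup G) [N.Normal]

/-- `x⁻¹ n x` as an element of the normal subgroup `N`. -/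
def conjInv (x : G) (n : N) : N :=
  ⟨x⁻¹ * n * x, by simpa using Subgroup.Normal.conj_mem inferInstance n.1 n.2 x⁻¹⟩

theorem conjInv_mul (x : G) (n n' : N) : conjInv N x (n * n') = conjInv N x n * conjInv N x n' :=
  Subtype.ext (by simp [conjInv]; group)

theorem conjInv_conjInv (x y : G) (n : N) :
    conjInv N y (conjInv N x n) = conjInv N (x * y) n :=
  Subtype.ext (by simp [conjInv]; group)

variable {N H} in
/-- The projection homomorphism `G = N ⋉ H → H`, `nh ↦ h`. -/
def projH (e : N × H ≃ G) (he : ∀ n h, e (n, h) = (n : G) * h) : G →* H where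
  toFun g := (e.symm g).2
  map_one' := by
    have := symm_mul e he 1 1
    simp only [Subgroup.coe_one, mul_one] at this
    rw [this]
  map_mul' g g' := by
    have h : g * g' = (((e.symm g).1 * conjInv N ((e.symm g).2 : G)⁻¹ (e.symm g').1 : N) : G) *
        ((e.symm g).2 * (e.symm g').2 : H) := by
      conv_lhs => rw [semidirect_eq e he g, semidirect_eq e he g']
      simp [conjInv, mul_assoc]
    conv_lhs => rw [h, symm_mul e he]

variable {N H} in
theorem symm_fst_mul (e : N × H ≃ G) (he : ∀ n h, e (n, h) = (n : G) * h)
    (g g' : G) :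
    (e.symm (g * g')).1 = (e.symm g).1 * conjInv N ((e.symm g).2 : G)⁻¹ (e.symm g').1 := by
  have h : g * g' = (((e.symm g).1 * conjInv N ((e.symm g).2 : G)⁻¹ (e.symm g').1 : N) : G) *
      ((e.symm g).2 * (e.symm g').2 : H) := by
    conv_lhs => rw [semidirect_eq e he g, semidirect_eq e he g']
    simp [conjInv, mul_assoc]
  rw [h, symm_mul e he]

variable [TopologicalSpace G] (ν : PontryaginDual N)

/-- The isotropy group `G_ν` of `ν` for the action `(x · ν)(n) = ν(x⁻¹ n x)`. -/
def isotropy : Subgroup G where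
  carrier := {x | ∀ n, ν (conjInv N x n) = ν n}
  one_mem' n := by
    congr 1
    exact Subtype.ext (by simp [conjInv])
  mul_mem' {x y} hx hy n := by
    rw [← conjInv_conjInv, hy, hx]
  inv_mem' {x} hx n := by
    rw [← hx, conjInv_conjInv]
    congr 1
    exact Subtype.ext (by simp [conjInv])

/-- The little group `H_ν = H ∩ G_ν`, as a subgroup of `H`. -/
def littleGroup : Subgroup H := (isotropy N ν).subgroupOf H

/-- The map `H/H_ν → G/G_ν`, `h H_ν ↦ h G_ν`. -/
def iota : H ⧸ littleGroup N H ν → G ⧸ isotropy N ν :=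
  Quotient.map' (fun h : H => (h : G)) fun a b hab => by
    rw [QuotientGroup.leftRel_apply] at hab ⊢
    exact hab

variable {N H} in
theorem iota_mk (h : H) : iota N H ν (h : H ⧸ littleGroup N H ν) = ((h : G) : G ⧸ isotropy N ν) :=
  rfl

variable {N H}

/-- The action of `G = N ⋉ H` on `H/H_ν`, `nh · y H_ν = h y H_ν`. -/
def baseAction (e : N × H ≃ G) (he : ∀ n h, e (n, h) = (n : G) * h) :
    G →* Equiv.Perm (H ⧸ littleGroup N H ν) :=
  (MulAction.toPermHom H (H ⧸ littleGroup N H ν)).comp (projH e he)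

variable [IsMulCommutative N]

theorem le_isotropy : N ≤ isotropy N ν := fun x hx n => by
  congr 1
  refine Subtype.ext ?_
  have : (⟨x, hx⟩ : N) * n = n * ⟨x, hx⟩ := mul_comm' _ _
  have h2 : x * (n : G) = n * x := congrArg Subtype.val this
  simp [conjInv, mul_assoc, ← h2]

theorem projH_mem (e : N × H ≃ G) (he : ∀ n h, e (n, h) = (n : G) * h)
    {g : G} (hg : g ∈ isotropy N ν) : (e.symm g).2 ∈ littleGroup N H ν := by
  change ((e.symm g).2 : G) ∈ isotropy N ν
  have h : ((e.symm g).2 : G) = ((e.symm g).1 : G)⁻¹ * g := by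
    conv_rhs => rw [semidirect_eq e he g]
    simp [symm_mul e he]
  rw [h]
  exact mul_mem (inv_mem (le_isotropy ν (e.symm g).1.2)) hg

/-- Multiplication by a complex number of modulus one, as a unitary operator. -/
def phase (V : Type*) [NormedAddCommGroup V] [InnerProductSpace ℂ V] : Circle →* (V ≃ₗᵢ[ℂ] V) where
  toFun z :=
    { toLinearEquiv := LinearEquiv.smulOfNeZero ℂ V (z : ℂ) z.coe_ne_zero
      norm_map' := fun v => by
        change ‖(z : ℂ) • v‖ = ‖v‖
        rw [norm_smul, Circle.norm_coe, one_mul] }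
  map_one' := by
    ext v
    change ((1 : Circle) : ℂ) • v = v
    simp
  map_mul' z w := by
    ext v
    change ((z * w : Circle) : ℂ) • v = (z : ℂ) • (w : ℂ) • v
    rw [Circle.coe_mul, mul_smul]

/-- The representation `νσ` of `G_ν = N ⋉ H_ν`, `νσ(nh) = ν(n) σ(h)`. -/
def nuSigma (e : N × H ≃ G) (he : ∀ n h, e (n, h) = (n : G) * h)
    {V : Type*} [NormedAddCommGroup V] [InnerProductSpace ℂ V]
    (σ : littleGroup N H ν →* (V ≃ₗᵢ[ℂ] V)) : isotropy N ν →* (V ≃ₗᵢ[ℂ] V) where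
  toFun g := phase V (ν (e.symm (g : G)).1) * σ ⟨(e.symm (g : G)).2, projH_mem ν e he g.2⟩
  map_one' := by
    have := symm_mul e he 1 1
    simp only [Subgroup.coe_one, mul_one] at this
    simp only [Subgroup.coe_one, this, map_one, one_mul]
    exact map_one σ
  map_mul' g g' := by
    have h1 : ν (e.symm ((g * g' : isotropy N ν) : G)).1 =
        ν (e.symm (g : G)).1 * ν (e.symm (g' : G)).1 := by
      rw [Subgroup.coe_mul, symm_fst_mul e he, map_mul]
      congr 1
      exact (inv_mem (projH_mem ν e he g.2) : ((e.symm (g : G)).2)⁻¹ ∈ littleGroup N H ν) _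
    have h2 : (⟨(e.symm ((g * g' : isotropy N ν) : G)).2, projH_mem ν e he (g * g').2⟩ :
        littleGroup N H ν) = ⟨(e.symm (g : G)).2, projH_mem ν e he g.2⟩ *
          ⟨(e.symm (g' : G)).2, projH_mem ν e he g'.2⟩ :=
      Subtype.ext ((projH e he).map_mul g g')
    rw [h1, h2, map_mul, map_mul]
    ext v
    simp [phase]

end Semidirect

/-! ## Invariant measures -/

section Measure

theorem measurePreserving_quotient {G : Type*} [Group G] [MeasurableSpace G] [MeasurableMul G]
    (S : Subgroup G) (μ : Measure (G ⧸ S)) [SMulInvariantMeasure G (G ⧸ S) μ] (g : G) :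
    MeasurePreserving (MulAction.toPermHom G (G ⧸ S) g) μ μ := by
  have h : Measurable fun q : G ⧸ S => g • q :=
    QuotientGroup.measurable_from_quotient.2
      (QuotientGroup.measurable_coe.comp (measurable_const_mul g))
  refine ⟨h, Measure.ext fun s hs => ?_⟩
  change Measure.map (fun q : G ⧸ S => g • q) μ s = μ s
  rw [Measure.map_apply h hs]
  exact SMulInvariantMeasure.measure_preimage_smul g hs

/-- Open sets of `G/S` are measurable. -/
instance opensMeasurableSpace_quotient {G : Type*} [Group G] [TopologicalSpace G]
    [MeasurableSpace G] [OpensMeasurableSpace G] (S : Subgroup G) :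
    OpensMeasurableSpace (G ⧸ S) :=
  ⟨MeasurableSpace.generateFrom_le fun s (hs : IsOpen s) =>
    (hs.preimage QuotientGroup.continuous_mk).measurableSet⟩

variable {G : Type*} [Group G] [TopologicalSpace G] [MeasurableSpace G]
  {N H : Subgroup G} [N.Normal] (ν : PontryaginDual N)

theorem measurable_iota : Measurable (iota N H ν) :=
  QuotientGroup.measurable_from_quotient.2
    (QuotientGroup.measurable_coe.comp measurable_subtype_coe)

/-- An `H`-invariant measure on `H/H_ν` is invariant for the action of `G = N ⋉ H`. -/
theorem measurePreserving_baseAction [MeasurableMul H] (e : N × H ≃ G)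
    (he : ∀ n h, e (n, h) = (n : G) * h) (μ : Measure (H ⧸ littleGroup N H ν))
    [SMulInvariantMeasure H (H ⧸ littleGroup N H ν) μ] (g : G) :
    MeasurePreserving (baseAction ν e he g) μ μ :=
  measurePreserving_quotient _ μ (projH e he g)

theorem iota_baseAction [IsMulCommutative N] (e : N × H ≃ G)
    (he : ∀ n h, e (n, h) = (n : G) * h) (g : G) (q : H ⧸ littleGroup N H ν) :
    iota N H ν (baseAction ν e he g q) = g • iota N H ν q := by
  obtain ⟨y, rfl⟩ := QuotientGroup.mk_surjective q
  change (((projH e he g * y : H) : G) : G ⧸ isotropy N ν) = ((g * (y : G) : G) : G ⧸ isotropy N ν)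
  rw [QuotientGroup.eq]
  have h : ((projH e he g * y : H) : G)⁻¹ * (g * y) =
      (conjInv N ((projH e he g * y : H) : G) (e.symm g).1 : G) := by
    have h0 : g = ((e.symm g).1 : G) * (projH e he g : G) := semidirect_eq e he g
    have h1 : g * (y : G) = ((e.symm g).1 : G) * ((projH e he g : G) * y) := by
      rw [← mul_assoc, ← h0]
    rw [h1]
    simp [conjInv, mul_assoc]
  rw [h]
  exact le_isotropy ν (Subtype.property _)

/-- The image on `G/G_ν` of an `H`-invariant measure on `H/H_ν` is `G`-invariant. -/
theorem measurePreserving_map_iota [IsMulCommutative N] [MeasurableMul G] [MeasurableMul H]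
    (e : N × H ≃ G) (he : ∀ n h, e (n, h) = (n : G) * h) (μ : Measure (H ⧸ littleGroup N H ν))
    [SMulInvariantMeasure H (H ⧸ littleGroup N H ν) μ] (g : G) :
    MeasurePreserving (MulAction.toPermHom G (G ⧸ isotropy N ν) g)
      (μ.map (iota N H ν)) (μ.map (iota N H ν)) := by
  have h : Measurable fun q : G ⧸ isotropy N ν => g • q :=
    QuotientGroup.measurable_from_quotient.2
      (QuotientGroup.measurable_coe.comp (measurable_const_mul g))
  have hb := measurePreserving_baseAction ν e he μ g
  refine ⟨h, ?_⟩
  change Measure.map (fun q : G ⧸ isotropy N ν => g • q) _ = _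
  rw [Measure.map_map h (measurable_iota ν)]
  conv_rhs => rw [← hb.map_eq, Measure.map_map (measurable_iota ν) hb.measurable]
  congr 1
  funext q
  exact (iota_baseAction ν e he g q).symm

end Measure

/-! ## The Wigner transformation -/

section Wigner

variable {H : Type*} [Group H] {S : Subgroup H} (L : H ⧸ S → H)
  (hL : ∀ q, ((L q : H) : H ⧸ S) = q)

/-- The Wigner transformation `W_L(x, q) = L(x q)⁻¹ x L(q)`, an element of `S`. -/
def wigner (x : H) (q : H ⧸ S) : S :=
  ⟨(L (x • q))⁻¹ * x * L q, by
    rw [mul_assoc, ← QuotientGroup.eq, hL]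
    conv_lhs => rw [← hL q]
    rfl⟩

end Wigner

end Perception

end

/-! Everything is governed by one cocycle. For `g = nh` the element `c(g, q) = L(gq)⁻¹ g L(q)` lies
in `G_ν`; its `N`-component is `L(hq)⁻¹ n L(hq)` and its `H`-component is `W_L(h, q)`. Applying `νσ`
gives the phase times `σ(W_L(h, q))`, which is exactly the fiber action on the boosting bundle
(`nuSigma_section`). The phase `ν((hy)⁻¹ n h y)` depends only on the coset of `y`, because `H_ν`
fixes `ν`; with `wigner_mul` and `boostPhase_mul` the formula is an action.

Since `Φ` extends `σ`, one has `Φ(L(hq)) σ(W_L(h, q)) = Φ(h) Φ(L(q))` on `H_σ`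
(`rep_section_wigner`). Hence the range of `A` is invariant and `A` is equivariant. The metric of
the perception bundle is the one of `H_σ` carried over by `A`; another representative of the coset
changes it by an element of `H_ν`, which acts unitarily on `H_σ` (`inner_rep_symm_section`).

An equivariant function on `G` is determined by its values along `L`, and every Borel section
extends to one by `g ↦ νσ(L(q)⁻¹ g)⁻¹ ψ(q)`, with `q` the coset of the `H`-component of `g`
(`equivariantFunctionsEquiv`). The cocycle turns left translation into the action on sections.

Both equivalences come from one mechanism: a linear bijection of spaces of Borel functions that
preserves the pointwise forms descends to a unitary operator of the `L²` spaces
(`FormField.l2Equiv`). So only `U_L` needs analysis. Its space is `L²(V)` with `V = H_σ`, hence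
complete, and equal to `L² ⊗ V` because `V` is finite-dimensional. Strong continuity need only be
tested at the identity on continuous sections of compact support, where `‖U_L(g)ψ - ψ‖²` is an
integral depending continuously on `g`. -/

noncomputable section

namespace Perception

/-! ### Unitary equivalence and strong continuity. -/

section UnitaryRepTransport

variable {G 𝓗 𝓗' 𝓗'' : Type*} [Group G]
  [NormedAddCommGroup 𝓗] [InnerProductSpace ℂ 𝓗] [NormedAddCommGroup 𝓗'] [InnerProductSpace ℂ 𝓗']
  [NormedAddCommGroup 𝓗''] [InnerProductSpace ℂ 𝓗'']
  {ρ : G →* (𝓗 ≃ₗᵢ[ℂ] 𝓗)} {ρ' : G →* (𝓗' ≃ₗᵢ[ℂ] 𝓗')} {ρ'' : G →* (𝓗'' ≃ₗᵢ[ℂ] 𝓗'')}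

theorem Intertwines.symm {T : 𝓗 ≃ₗᵢ[ℂ] 𝓗'} (h : Intertwines ρ ρ' T) :
    Intertwines ρ' ρ T.symm := fun g v => by
  rw [LinearIsometryEquiv.symm_apply_eq, h, T.apply_symm_apply]

theorem UnitarilyEquivalent.symm (h : UnitarilyEquivalent ρ ρ') : UnitarilyEquivalent ρ' ρ :=
  let ⟨T, hT⟩ := h
  ⟨T.symm, hT.symm⟩

theorem UnitarilyEquivalent.trans (h : UnitarilyEquivalent ρ ρ')
    (h' : UnitarilyEquivalent ρ' ρ'') : UnitarilyEquivalent ρ ρ'' :=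
  let ⟨T, hT⟩ := h
  let ⟨T', hT'⟩ := h'
  ⟨T.trans T', fun g v => by
    rw [LinearIsometryEquiv.trans_apply, hT, hT', LinearIsometryEquiv.trans_apply]⟩

/-- Only the boosting representation is analysed directly; completeness and strong continuity reach
the other two through this transfer. -/
theorem IsUnitaryRepresentation.of_equivalent [TopologicalSpace G]
    (hρ : IsUnitaryRepresentation ρ) (h : UnitarilyEquivalent ρ ρ') :
    IsUnitaryRepresentation ρ' := by
  obtain ⟨T, hT⟩ := h
  have := hρ.1
  refine ⟨(completeSpace_congr T.isometry.isUniformInducing.isUniformEmbedding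
    (e := T.toEquiv)).1 hρ.1, fun v => ?_⟩
  have h1 : (fun g => ρ' g v) = fun g => T (ρ g (T.symm v)) := by
    funext g
    rw [hT, T.apply_symm_apply]
  rw [h1]
  exact T.continuous.comp (hρ.2 _)

/-- A homomorphism into the unitary group is strongly continuous if its orbit maps are continuous
at the identity for a dense set of vectors. -/
theorem continuous_orbit_of_dense [TopologicalSpace G] [IsTopologicalGroup G] {s : Set 𝓗}
    (hs : Dense s) (h : ∀ v ∈ s, ContinuousAt (fun g => ρ g v) 1) (v : 𝓗) :
    Continuous fun g => ρ g v := by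
  have h1 : ContinuousAt (fun g => ρ g v) 1 := by
    rw [Metric.continuousAt_iff']
    intro ε hε
    obtain ⟨w, hw, hvw⟩ := Metric.mem_closure_iff.1 (hs v) (ε / 3) (by positivity)
    filter_upwards [Metric.continuousAt_iff'.1 (h w hw) (ε / 3) (by positivity)] with g hg
    have e1 : dist (ρ g v) (ρ g w) = dist v w := (ρ g).dist_map v w
    have e2 : dist (ρ 1 w) (ρ 1 v) = dist w v := (ρ 1).dist_map w v
    have t1 := dist_triangle4 (ρ g v) (ρ g w) (ρ 1 w) (ρ 1 v)
    rw [e1, e2, dist_comm w v] at t1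
    linarith
  rw [continuous_iff_continuousAt]
  intro g₀
  -- Translating by `g₀` reduces continuity at `g₀` to continuity at the identity.
  have h2 : (fun g => ρ g v) = fun g => ρ g₀ (ρ (g₀⁻¹ * g) v) := by
    funext g
    change ρ g v = (ρ g₀ * ρ (g₀⁻¹ * g)) v
    rw [← map_mul, mul_inv_cancel_left]
  rw [h2]
  refine (ρ g₀).continuous.continuousAt.comp ?_
  have h3 : ContinuousAt (fun g => ρ g v) (g₀⁻¹ * g₀) := by rwa [inv_mul_cancel]
  exact ContinuousAt.comp (f := fun g => g₀⁻¹ * g) h3 (continuous_const_mul _).continuousAt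

end UnitaryRepTransport

/-! ### Unitary operators from form-preserving bijections. -/

namespace FormField

variable {M M' : Type*} [MeasurableSpace M] [MeasurableSpace M']
  {𝓑 𝓑' : Type*} [AddCommGroup 𝓑] [Module ℂ 𝓑] [AddCommGroup 𝓑'] [Module ℂ 𝓑']
  {D : FormField M 𝓑} {D' : FormField M' 𝓑'} {μ : Measure M} {μ' : Measure M'} {ι : M → M'}

/-- A change of variables along `ι`, which need not be bijective: all invertibility sits in `T`. The
cases needed are `ι = id`, for a bundle isomorphism, and `ι = iota`, for the induced representation.
-/
theorem sqIntegrable_map_iff (hι : MeasurePreserving ι μ μ') {T : 𝓑 ≃ₗ[ℂ] 𝓑'}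
    (hT : ∀ x f f', D'.form (ι x) (T f) (T f') = D.form x f f') (f : 𝓑) :
    D'.SqIntegrable μ' (T f) ↔ D.SqIntegrable μ f := by
  unfold SqIntegrable
  have hm : Measurable fun x => ENNReal.ofReal (D'.form x (T f) (T f)).re :=
    (Complex.measurable_re.comp (measurable_form' _ _)).ennreal_ofReal
  rw [← hι.lintegral_comp hm]
  simp only [hT]

theorem integral_form_map (hι : MeasurePreserving ι μ μ') {T : 𝓑 ≃ₗ[ℂ] 𝓑'}
    (hT : ∀ x f f', D'.form (ι x) (T f) (T f') = D.form x f f') (f f' : 𝓑) :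
    ∫ x, D'.form x (T f) (T f') ∂μ' = ∫ x, D.form x f f' ∂μ := by
  rw [← hι.map_eq, integral_map hι.measurable.aemeasurable
    (measurable_form' _ _).aestronglyMeasurable]
  simp only [hT]

/-- The isometry of spaces of square-integrable elements that comes from a form-preserving
equivalence. -/
def preL2Equiv (hι : MeasurePreserving ι μ μ') (T : 𝓑 ≃ₗ[ℂ] 𝓑')
    (hT : ∀ x f f', D'.form (ι x) (T f) (T f') = D.form x f f') :
    D.PreL2 μ ≃ₗᵢ[ℂ] D'.PreL2 μ' where
  toFun f := ⟨T f.val, (sqIntegrable_map_iff hι hT _).2 f.property⟩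
  invFun f := ⟨T.symm f.val, (sqIntegrable_map_iff hι hT _).1 (by
    rw [T.apply_symm_apply]
    exact f.property)⟩
  map_add' f f' := PreL2.ext (T.map_add f.val f'.val)
  map_smul' c f := PreL2.ext (T.map_smul c f.val)
  left_inv f := PreL2.ext (T.symm_apply_apply f.val)
  right_inv f := PreL2.ext (T.apply_symm_apply f.val)
  norm_map' f := by
    rw [@norm_eq_sqrt_re_inner ℂ, @norm_eq_sqrt_re_inner ℂ _ _ _ _ f]
    congr 2
    exact integral_form_map hι hT f.val f.val

/-- An isometry of seminormed spaces descends to the separation quotients. -/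
def separationQuotientEquiv {E F : Type*} [SeminormedAddCommGroup E] [InnerProductSpace ℂ E]
    [SeminormedAddCommGroup F] [InnerProductSpace ℂ F] (T : E ≃ₗᵢ[ℂ] F) :
    SeparationQuotient E ≃ₗᵢ[ℂ] SeparationQuotient F where
  toFun := SeparationQuotient.lift (fun f => SeparationQuotient.mk (T f))
    fun _ _ h => SeparationQuotient.mk_eq_mk.2 (h.map T.continuous)
  invFun := SeparationQuotient.lift (fun f => SeparationQuotient.mk (T.symm f))
    fun _ _ h => SeparationQuotient.mk_eq_mk.2 (h.map T.symm.continuous)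
  map_add' := by
    rintro ⟨f⟩ ⟨f'⟩
    exact congrArg SeparationQuotient.mk (T.map_add f f')
  map_smul' c := by
    rintro ⟨f⟩
    exact congrArg SeparationQuotient.mk (T.map_smul c f)
  left_inv := by
    rintro ⟨f⟩
    exact congrArg SeparationQuotient.mk (T.symm_apply_apply f)
  right_inv := by
    rintro ⟨f⟩
    exact congrArg SeparationQuotient.mk (T.apply_symm_apply f)
  norm_map' := by
    rintro ⟨f⟩
    exact T.norm_map f

/-- The unitary operator of `L²` spaces that comes from a form-preserving equivalence. -/
def l2Equiv (hι : MeasurePreserving ι μ μ') (T : 𝓑 ≃ₗ[ℂ] 𝓑')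
    (hT : ∀ x f f', D'.form (ι x) (T f) (T f') = D.form x f f') :
    D.L2 μ ≃ₗᵢ[ℂ] D'.L2 μ' :=
  separationQuotientEquiv (preL2Equiv hι T hT)

theorem l2Equiv_intertwines {G : Type*} [Group G] {ρ : G →* Module.End ℂ 𝓑}
    {ρ' : G →* Module.End ℂ 𝓑'} {l : G →* Equiv.Perm M} {l' : G →* Equiv.Perm M'}
    (hι : MeasurePreserving ι μ μ') (T : 𝓑 ≃ₗ[ℂ] 𝓑')
    (hT : ∀ x f f', D'.form (ι x) (T f) (T f') = D.form x f f')
    (hl : ∀ g, MeasurePreserving (l g) μ μ)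
    (h : ∀ g x f f', D.form (l g x) (ρ g f) (ρ g f') = D.form x f f')
    (hl' : ∀ g, MeasurePreserving (l' g) μ' μ')
    (h' : ∀ g x f f', D'.form (l' g x) (ρ' g f) (ρ' g f') = D'.form x f f')
    (hρ : ∀ g f, T (ρ g f) = ρ' g (T f)) :
    Intertwines (unitaryRep hl h) (unitaryRep hl' h') (l2Equiv hι T hT) := by
  rintro g ⟨f⟩
  exact congrArg SeparationQuotient.mk (PreL2.ext (hρ g f.val))

end FormField

/-! ### The Wigner cocycle. -/

section Cocycles

variable {H : Type*} [Group H] {S : Subgroup H} (L : H ⧸ S → H)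
  (hL : ∀ q, ((L q : H) : H ⧸ S) = q)

theorem wigner_one (q : H ⧸ S) : wigner L hL 1 q = 1 :=
  Subtype.ext (by simp [wigner])

/-- The inner factors `L(x'q)⁻¹` and `L(x'q)` cancel. -/
theorem wigner_mul (x x' : H) (q : H ⧸ S) :
    wigner L hL (x * x') q = wigner L hL x (x' • q) * wigner L hL x' q :=
  Subtype.ext (by simp [wigner, mul_smul, mul_assoc])

theorem section_mul_wigner (x : H) (q : H ⧸ S) :
    L (x • q) * (wigner L hL x q : H) = x * L q := by
  simp [wigner, mul_assoc]

include hL in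
theorem section_inv_mul_mem (x : H) : (L (x : H ⧸ S))⁻¹ * x ∈ S := by
  rw [← QuotientGroup.eq, hL]

end Cocycles

/-! ### The phase cocycle of the character. -/

section Phase

variable {G : Type*} [Group G] [TopologicalSpace G] {N H : Subgroup G} [N.Normal]
  (ν : PontryaginDual N)

/-- This is why the phase does not depend on the representative of a coset. -/
theorem character_conjInv_mul {k : H} (hk : k ∈ littleGroup N H ν) (x : G) (n : N) :
    ν (conjInv N (x * k) n) = ν (conjInv N x n) := by
  rw [← conjInv_conjInv]
  exact hk _

variable (e : N × H ≃ G) (he : ∀ n h, e (n, h) = (n : G) * h)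
  (L : H ⧸ littleGroup N H ν → H) (hL : ∀ q, ((L q : H) : H ⧸ littleGroup N H ν) = q)

include hL in
theorem character_conjInv_section (x : G) (y : H) (n : N) :
    ν (conjInv N (x * L (y : H ⧸ littleGroup N H ν)) n) = ν (conjInv N (x * y) n) := by
  rw [← character_conjInv_mul ν (section_inv_mul_mem L hL y)]
  simp [mul_assoc]

/-- The phase `ν((hy)⁻¹ n h y)` by which `nh` multiplies the fiber at `y H_ν`, with the
representative `y = L(y H_ν)`. -/
def boostPhase (g : G) (q : H ⧸ littleGroup N H ν) : Circle :=
  ν (conjInv N ((projH e he g : G) * L q) (e.symm g).1)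

include hL in
theorem boostPhase_mul_mk (n : N) (h y : H) :
    boostPhase ν e he L ((n : G) * h) (y : H ⧸ littleGroup N H ν) =
      ν (conjInv N ((h : G) * y) n) := by
  rw [boostPhase, character_conjInv_section ν L hL]
  simp [projH, symm_mul e he]

theorem baseAction_apply (g : G) (q : H ⧸ littleGroup N H ν) :
    baseAction ν e he g q = projH e he g • q := rfl

theorem baseAction_mul_mk (n : N) (h y : H) :
    baseAction ν e he ((n : G) * h) (y : H ⧸ littleGroup N H ν) =
      ((h * y : H) : H ⧸ littleGroup N H ν) := by
  rw [baseAction_apply]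
  simp only [projH, MonoidHom.coe_mk, OneHom.coe_mk, symm_mul e he]
  rfl

omit [TopologicalSpace G] in
theorem projH_mul_coe (n : N) (h : H) : projH e he ((n : G) * h) = h := by
  simp [projH, symm_mul e he]

theorem boostPhase_one (q : H ⧸ littleGroup N H ν) : boostPhase ν e he L 1 q = 1 := by
  have h := symm_mul e he 1 1
  simp only [Subgroup.coe_one, mul_one] at h
  rw [boostPhase, h]
  have h2 : conjInv N ((projH e he 1 : G) * L q) 1 = 1 := Subtype.ext (by simp [conjInv])
  rw [h2, map_one]

-- The `N`-component of `gg'` is `n · h n' h⁻¹`, so the phase splits into a factor for `n` and one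
-- for `n'`; in the latter the conjugation by `h` cancels.
include hL in
theorem boostPhase_mul (g g' : G) (q : H ⧸ littleGroup N H ν) :
    boostPhase ν e he L (g * g') q =
      boostPhase ν e he L g (baseAction ν e he g' q) * boostPhase ν e he L g' q := by
  unfold boostPhase
  rw [symm_fst_mul e he, conjInv_mul, map_mul, conjInv_conjInv, map_mul, Subgroup.coe_mul]
  congr 1
  -- The product produces the representative `h' L(q)` of the coset `g'q`, while the phase is
  -- defined with `L(g'q)`.
  · have h := character_conjInv_section ν L hL (projH e he g) (projH e he g' * L q) (e.symm g).1
    have h' : ((projH e he g' * L q : H) : H ⧸ littleGroup N H ν) = baseAction ν e he g' q := by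
      conv_rhs => rw [← hL q]
      rfl
    rw [h'] at h
    rw [h, Subgroup.coe_mul, mul_assoc]
  · congr 2
    change ((projH e he g : H) : G)⁻¹ * _ = _
    simp [mul_assoc]

end Phase

/-! ### Smoothness of the actions and cocycles. -/

section Smooth

/-- Manifolds are real but the operators are complex linear: evaluation is bounded bilinear over
`ℂ`, hence smooth over `ℂ`, and then over `ℝ`. -/
theorem ContMDiff.complex_clm_apply {E H' M V W : Type*} [NormedAddCommGroup E] [NormedSpace ℝ E]
    [TopologicalSpace H'] {I : ModelWithCorners ℝ E H'} [TopologicalSpace M] [ChartedSpace H' M]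
    [NormedAddCommGroup V] [NormedSpace ℂ V] [NormedAddCommGroup W] [NormedSpace ℂ W]
    {T : M → V →L[ℂ] W} {f : M → V} (hT : ContMDiff I 𝓘(ℝ, V →L[ℂ] W) ∞ T)
    (hf : ContMDiff I 𝓘(ℝ, V) ∞ f) : ContMDiff I 𝓘(ℝ, W) ∞ fun x => T x (f x) := by
  have h : ContDiff ℂ ∞ fun p : (V →L[ℂ] W) × V => p.1 p.2 := isBoundedBilinearMap_apply.contDiff
  exact (h.restrict_scalars ℝ).contMDiff.comp (hT.prodMk_space hf)

theorem ContMDiff.complex_smul {E H' M V : Type*} [NormedAddCommGroup E] [NormedSpace ℝ E]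
    [TopologicalSpace H'] {I : ModelWithCorners ℝ E H'} [TopologicalSpace M] [ChartedSpace H' M]
    [NormedAddCommGroup V] [NormedSpace ℂ V]
    {c : M → ℂ} {f : M → V} (hc : ContMDiff I 𝓘(ℝ, ℂ) ∞ c)
    (hf : ContMDiff I 𝓘(ℝ, V) ∞ f) : ContMDiff I 𝓘(ℝ, V) ∞ fun x => c x • f x := by
  have h : ContDiff ℝ ∞ fun p : ℂ × V => p.1 • p.2 := contDiff_smul
  exact h.contMDiff.comp (hc.prodMk_space hf)

theorem contMDiff_circle_coe : ContMDiff (𝓡 1) 𝓘(ℝ, ℂ) ∞ fun z : Circle => (z : ℂ) := by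
  have : Fact (Module.finrank ℝ ℂ = 1 + 1) := Complex.finrank_real_complex_fact
  have h : ContMDiff (𝓡 1) 𝓘(ℝ, ℂ) ∞ (Subtype.val : Metric.sphere (0 : ℂ) 1 → ℂ) :=
    contMDiff_coe_sphere
  exact h

variable {G EG EN EH EM K : Type*}
    [Group G] [TopologicalSpace G]
    [NormedAddCommGroup EG] [NormedSpace ℝ EG] [ChartedSpace EG G]
    {N H : Subgroup G}
    [NormedAddCommGroup EN] [NormedSpace ℝ EN] [ChartedSpace EN N]
    [NormedAddCommGroup EH] [NormedSpace ℝ EH] [ChartedSpace EH H]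
    (e : Diffeomorph (𝓘(ℝ, EN).prod 𝓘(ℝ, EH)) 𝓘(ℝ, EG) (N × H) G ∞)
    (he : ∀ (n : N) (h : H), e (n, h) = (n : G) * h)

-- The manifold structures of `N` and `H` are tied to that of `G` through `e` alone, so even the
-- inclusions have to be read off from `e`.
include he in
theorem contMDiff_coe_left : ContMDiff 𝓘(ℝ, EN) 𝓘(ℝ, EG) ∞ ((↑) : N → G) := by
  have h : ((↑) : N → G) = fun n => e (n, 1) := by
    funext n
    simp [he]
  rw [h]
  exact e.contMDiff.comp (contMDiff_id.prodMk contMDiff_const)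

include he in
theorem contMDiff_coe_right : ContMDiff 𝓘(ℝ, EH) 𝓘(ℝ, EG) ∞ ((↑) : H → G) := by
  have h : ((↑) : H → G) = fun n => e (1, n) := by
    funext n
    simp [he]
  rw [h]
  exact e.contMDiff.comp (contMDiff_const.prodMk contMDiff_id)

variable [N.Normal]

theorem contMDiff_projH : ContMDiff 𝓘(ℝ, EG) 𝓘(ℝ, EH) ∞ (projH e.toEquiv he) :=
  contMDiff_snd.comp e.symm.contMDiff

variable [LieGroup 𝓘(ℝ, EG) ∞ G]

-- Smoothness into `N` itself, not merely into `G`: `x⁻¹ n x` is its own `N`-component, and taking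
-- the `N`-component is smooth on `G`.
include e he in
theorem contMDiff_conjInv :
    ContMDiff (𝓘(ℝ, EG).prod 𝓘(ℝ, EN)) 𝓘(ℝ, EN) ∞ fun p : G × N => conjInv N p.1 p.2 := by
  have h : (fun p : G × N => conjInv N p.1 p.2) = fun p => (e.symm (p.1⁻¹ * p.2 * p.1)).1 := by
    funext p
    have h1 := symm_mul e.toEquiv he (conjInv N p.1 p.2) 1
    rw [Subgroup.coe_one, mul_one] at h1
    exact (congrArg Prod.fst h1).symm
  rw [h]
  refine contMDiff_fst.comp (e.symm.contMDiff.comp ?_)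
  exact (contMDiff_fst.inv.mul ((contMDiff_coe_left e he).comp contMDiff_snd)).mul contMDiff_fst

variable [LieGroup 𝓘(ℝ, EH) ∞ H] (ν : PontryaginDual N) (hν : ContMDiff 𝓘(ℝ, EN) (𝓡 1) ∞ ν)
    [NormedAddCommGroup EM] [NormedSpace ℝ EM] [ChartedSpace EM (H ⧸ littleGroup N H ν)]
    (hπ : ContMDiff 𝓘(ℝ, EH) 𝓘(ℝ, EM) ∞ (QuotientGroup.mk : H → H ⧸ littleGroup N H ν))
    (L : H ⧸ littleGroup N H ν → H)
    (hL : ∀ q, ((L q : H) : H ⧸ littleGroup N H ν) = q)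
    (hL' : ContMDiff 𝓘(ℝ, EM) 𝓘(ℝ, EH) ∞ L)

-- The action is `(g, q) ↦ π(h L(q))`, so the global section replaces any descent argument along
-- `π`.
omit [LieGroup 𝓘(ℝ, EG) ∞ G] in
include hπ hL hL' in
theorem contMDiff_baseAction : ContMDiff (𝓘(ℝ, EG).prod 𝓘(ℝ, EM)) 𝓘(ℝ, EM) ∞
    fun p : G × (H ⧸ littleGroup N H ν) => baseAction ν e.toEquiv he p.1 p.2 := by
  have h : (fun p : G × (H ⧸ littleGroup N H ν) => baseAction ν e.toEquiv he p.1 p.2) =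
      fun p => ((projH e.toEquiv he p.1 * L p.2 : H) : H ⧸ littleGroup N H ν) := by
    funext p
    conv_lhs => rw [← hL p.2]
    rfl
  rw [h]
  exact hπ.comp (((contMDiff_projH e he).comp contMDiff_fst).mul (hL'.comp contMDiff_snd))

omit [LieGroup 𝓘(ℝ, EH) ∞ H] in
include hν hL' in
theorem contMDiff_boostPhase : ContMDiff (𝓘(ℝ, EG).prod 𝓘(ℝ, EM)) 𝓘(ℝ, ℂ) ∞
    fun p : G × (H ⧸ littleGroup N H ν) => (boostPhase ν e.toEquiv he L p.1 p.2 : ℂ) := by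
  refine contMDiff_circle_coe.comp (hν.comp ((contMDiff_conjInv e he).comp
    (ContMDiff.prodMk ?_ ?_)))
  · exact ((contMDiff_coe_right e he).comp ((contMDiff_projH e he).comp contMDiff_fst)).mul
      ((contMDiff_coe_right e he).comp (hL'.comp contMDiff_snd))
  · exact contMDiff_fst.comp (e.symm.contMDiff.comp contMDiff_fst)

omit [LieGroup 𝓘(ℝ, EG) ∞ G] in
include hπ hL' in
theorem contMDiff_wigner : ContMDiff (𝓘(ℝ, EG).prod 𝓘(ℝ, EM)) 𝓘(ℝ, EH) ∞
    fun p : G × (H ⧸ littleGroup N H ν) => (wigner L hL (projH e.toEquiv he p.1) p.2).1 :=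
  ((hL'.comp (contMDiff_baseAction e he ν hπ L hL hL')).inv.mul
    ((contMDiff_projH e he).comp contMDiff_fst)).mul (hL'.comp contMDiff_snd)

end Smooth

/-! ### The boosting and perception bundles and the isomorphism `A`. -/

section Bundles

variable {G EG EN EH EM K : Type*}
    [Group G] [TopologicalSpace G]
    [NormedAddCommGroup EG] [NormedSpace ℝ EG] [ChartedSpace EG G] [LieGroup 𝓘(ℝ, EG) ∞ G]
    {N H : Subgroup G} [N.Normal]
    [NormedAddCommGroup EN] [NormedSpace ℝ EN] [ChartedSpace EN N]
    [NormedAddCommGroup EH] [NormedSpace ℝ EH] [ChartedSpace EH H] [LieGroup 𝓘(ℝ, EH) ∞ H]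
    (e : Diffeomorph (𝓘(ℝ, EN).prod 𝓘(ℝ, EH)) 𝓘(ℝ, EG) (N × H) G ∞)
    (he : ∀ (n : N) (h : H), e (n, h) = (n : G) * h)
    (ν : PontryaginDual N) (hν : ContMDiff 𝓘(ℝ, EN) (𝓡 1) ∞ ν)
    [NormedAddCommGroup EM] [NormedSpace ℝ EM] [ChartedSpace EM (H ⧸ littleGroup N H ν)]
    (hπ : ContMDiff 𝓘(ℝ, EH) 𝓘(ℝ, EM) ∞ (QuotientGroup.mk : H → H ⧸ littleGroup N H ν))
    [NormedAddCommGroup K] [InnerProductSpace ℂ K] [FiniteDimensional ℂ K]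
    {Hσ : Submodule ℂ K} (σ : littleGroup N H ν →* (Hσ ≃ₗᵢ[ℂ] Hσ))
    (Φ : H →* (K ≃L[ℂ] K))
    (hΦ : ContMDiff 𝓘(ℝ, EH) 𝓘(ℝ, K →L[ℂ] K) ∞ fun h => (Φ h : K →L[ℂ] K))
    (hσΦ : ∀ (k : littleGroup N H ν) (v : Hσ), Φ (k : H) (v : K) = (σ k v : K))
    (L : H ⧸ littleGroup N H ν → H)
    (hL : ∀ q, ((L q : H) : H ⧸ littleGroup N H ν) = q)
    (hL' : ContMDiff 𝓘(ℝ, EM) 𝓘(ℝ, EH) ∞ L)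

section Algebra

omit [FiniteDimensional ℂ K]

theorem rep_symm_apply {H K : Type*} [Group H] [NormedAddCommGroup K] [NormedSpace ℂ K]
    (Φ : H →* (K ≃L[ℂ] K)) (x : H) (v : K) : (Φ x).symm v = Φ x⁻¹ v := by
  rw [map_inv]
  rfl

theorem rep_mul_apply {H K : Type*} [Group H] [NormedAddCommGroup K] [NormedSpace ℂ K]
    (Φ : H →* (K ≃L[ℂ] K)) (x y : H) (v : K) : Φ (x * y) v = Φ x (Φ y v) := by
  rw [map_mul]
  rfl

theorem inner_circle_smul {V : Type*} [NormedAddCommGroup V] [InnerProductSpace ℂ V] (z : Circle)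
    (u v : V) : inner ℂ ((z : ℂ) • u) ((z : ℂ) • v) = inner ℂ u v :=
  (phase V z).inner_map_map u v

theorem re_inner_self_pos {V : Type*} [NormedAddCommGroup V] [InnerProductSpace ℂ V] {u : V}
    (hu : u ≠ 0) : 0 < (inner ℂ u u).re := by
  have h : (inner ℂ u u).re = ‖u‖ ^ 2 := inner_self_eq_norm_sq (𝕜 := ℂ) u
  rw [h]
  exact pow_pos (norm_pos_iff.2 hu) 2

variable {ν σ Φ}

-- Apply `Φ` to `L(hq) W_L(h, q) = h L(q)`. This identity yields both the invariance of the
-- perception fibers and the equivariance of `A`.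
include hσΦ in
theorem rep_section_wigner (h : H) (q : H ⧸ littleGroup N H ν) (v : Hσ) :
    Φ (L (h • q)) (σ (wigner L hL h q) v : K) = Φ h (Φ (L q) v) := by
  rw [← hσΦ, ← rep_mul_apply, ← rep_mul_apply, section_mul_wigner]

-- On `H_σ` the operator `Φ(x)⁻¹ Φ(L(xH_ν))` is `σ(k)⁻¹` with `k = L(xH_ν)⁻¹ x ∈ H_ν`, hence
-- unitary. It makes the perception metric independent of the representative.
include hσΦ hL in
theorem inner_rep_symm_section (x : H) (v w : Hσ) :
    inner ℂ ((Φ x).symm (Φ (L (x : H ⧸ littleGroup N H ν)) v))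
      ((Φ x).symm (Φ (L (x : H ⧸ littleGroup N H ν)) w)) = inner ℂ v w := by
  have h1 : ∀ v : Hσ, (Φ x).symm (Φ (L (x : H ⧸ littleGroup N H ν)) v) =
      (σ ⟨(L (x : H ⧸ littleGroup N H ν))⁻¹ * x, section_inv_mul_mem L hL x⟩⁻¹ v : K) := by
    intro v
    rw [rep_symm_apply, ← rep_mul_apply, ← hσΦ]
    simp
  rw [h1, h1, ← Submodule.coe_inner, LinearIsometryEquiv.inner_map_map]

end Algebra

theorem contMDiff_group_base {V : Type*} [NormedAddCommGroup V] [NormedSpace ℂ V]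
    {G M : Type*} [TopologicalSpace G] [ChartedSpace EG G] [TopologicalSpace M]
    [ChartedSpace EM M] :
    ContMDiff (𝓘(ℝ, EG).prod (𝓘(ℝ, EM).prod 𝓘(ℝ, V))) (𝓘(ℝ, EG).prod 𝓘(ℝ, EM)) ∞
      fun p : G × (M × V) => (p.1, p.2.1) :=
  contMDiff_fst.prodMk (contMDiff_fst.comp contMDiff_snd)

theorem contDiff_complex_clm {V W : Type*} [NormedAddCommGroup V] [NormedSpace ℂ V]
    [NormedAddCommGroup W] [NormedSpace ℂ W] (T : V →L[ℂ] W) : ContDiff ℝ ∞ T :=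
  (T.contDiff (n := ∞)).restrict_scalars ℝ

omit [LieGroup 𝓘(ℝ, EG) ∞ G] [FiniteDimensional ℂ K] in
include hπ hΦ hL' in
theorem contMDiff_rep_wigner :
    ContMDiff (𝓘(ℝ, EG).prod (𝓘(ℝ, EM).prod 𝓘(ℝ, Hσ))) 𝓘(ℝ, K) ∞
      fun p : G × ((H ⧸ littleGroup N H ν) × Hσ) =>
        Φ (wigner L hL (projH e.toEquiv he p.1) p.2.1).1 (p.2.2 : K) := by
  have h3 : ContMDiff (𝓘(ℝ, EG).prod (𝓘(ℝ, EM).prod 𝓘(ℝ, Hσ))) 𝓘(ℝ, K) ∞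
      fun p : G × ((H ⧸ littleGroup N H ν) × Hσ) => (p.2.2 : K) :=
    (contDiff_complex_clm Hσ.subtypeL).contMDiff.comp (contMDiff_snd.comp contMDiff_snd)
  have hw : ContMDiff (𝓘(ℝ, EG).prod (𝓘(ℝ, EM).prod 𝓘(ℝ, Hσ))) 𝓘(ℝ, EH) ∞
      fun p : G × ((H ⧸ littleGroup N H ν) × Hσ) =>
        (wigner L hL (projH e.toEquiv he p.1) p.2.1).1 := by
    have h5 := (contMDiff_wigner e he ν hπ L hL hL').comp
      (contMDiff_group_base (EG := EG) (EM := EM) (V := Hσ))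
    exact h5
  have h4 : ContMDiff (𝓘(ℝ, EG).prod (𝓘(ℝ, EM).prod 𝓘(ℝ, Hσ))) 𝓘(ℝ, K →L[ℂ] K) ∞
      fun p : G × ((H ⧸ littleGroup N H ν) × Hσ) =>
        (Φ (wigner L hL (projH e.toEquiv he p.1) p.2.1).1 : K →L[ℂ] K) :=
    hΦ.comp hw
  exact ContMDiff.complex_clm_apply h4 h3

-- Smoothness of `σ` is inherited from `Φ`; the orthogonal projection onto `H_σ`, harmless on
-- vectors already there, turns a smooth map into `K` into one into `H_σ`.
omit [LieGroup 𝓘(ℝ, EG) ∞ G] in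
include hπ hΦ hσΦ hL' in
theorem contMDiff_sigma_wigner :
    ContMDiff (𝓘(ℝ, EG).prod (𝓘(ℝ, EM).prod 𝓘(ℝ, Hσ))) 𝓘(ℝ, Hσ) ∞
      fun p : G × ((H ⧸ littleGroup N H ν) × Hσ) =>
        σ (wigner L hL (projH e.toEquiv he p.1) p.2.1) p.2.2 := by
  have h : (fun p : G × ((H ⧸ littleGroup N H ν) × Hσ) =>
      σ (wigner L hL (projH e.toEquiv he p.1) p.2.1) p.2.2) = fun p =>
        Hσ.orthogonalProjectionOnto
          (Φ (wigner L hL (projH e.toEquiv he p.1) p.2.1).1 (p.2.2 : K)) := by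
    funext p
    rw [hσΦ, Submodule.orthogonalProjectionOnto_mem_subspace_eq_self]
  rw [h]
  exact (contDiff_complex_clm Hσ.orthogonalProjectionOnto).contMDiff.comp
    (contMDiff_rep_wigner e he ν hπ Φ hΦ L hL hL')

/-- The boosting bundle. -/
def boostingBundle : HermitianGBundle EG EM (baseAction ν e.toEquiv he) Hσ where
  rank := Module.finrank ℂ Hσ
  fiber _ := ⊤
  isSubbundle _ := ⟨univ, isOpen_univ, mem_univ _, fun i _ => Module.finBasis ℂ Hσ i,
    fun _ => contMDiffOn_const,
    fun _ _ => ⟨(Module.finBasis ℂ Hσ).linearIndependent, (Module.finBasis ℂ Hσ).span_eq⟩⟩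
  metric _ v w := inner ℂ v w
  metric_add_left _ _ _ _ _ _ _ := inner_add_left _ _ _
  metric_smul_left _ _ _ _ _ _ := inner_smul_left _ _ _
  metric_conj _ _ _ _ _ := inner_conj_symm _ _
  metric_pos _ _ _ hu := re_inner_self_pos hu
  smooth_metric := by
    have h : ContDiff ℝ ∞ fun p : Hσ × Hσ => (inner ℂ p.1 p.2 : ℂ) := contDiff_inner
    refine ContMDiff.contMDiffOn ?_
    exact h.contMDiff.comp ((contMDiff_fst.comp contMDiff_snd).prodMk_space
      (contMDiff_snd.comp contMDiff_snd))
  smooth_base := contMDiff_baseAction e he ν hπ L hL hL'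
  act g p := (baseAction ν e.toEquiv he g p.1, (boostPhase ν e.toEquiv he L g p.1 : ℂ) •
    σ (wigner L hL (projH e.toEquiv he g) p.1) p.2)
  act_fst _ _ _ := rfl
  act_mem _ _ _ := trivial
  act_one p _ := by
    simp [boostPhase_one, wigner_one]
  act_mul g g' p _ := by
    refine Prod.ext (by simp) ?_
    simp only [boostPhase_mul ν e.toEquiv he L hL, map_mul, wigner_mul, map_smul, smul_smul,
      Circle.coe_mul]
    rfl
  act_add _ _ _ _ _ _ := by simp
  act_smul _ _ _ _ _ := by
    simp only [map_smul]
    rw [smul_comm]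
  act_isometry _ _ _ _ _ _ := by
    rw [inner_circle_smul, LinearIsometryEquiv.inner_map_map]
  smooth_act := by
    refine ContMDiff.contMDiffOn (ContMDiff.prodMk ?_ (ContMDiff.complex_smul ?_ ?_))
    · exact (contMDiff_baseAction e he ν hπ L hL hL').comp contMDiff_group_base
    · exact (contMDiff_boostPhase e he ν hν L hL').comp contMDiff_group_base
    · exact contMDiff_sigma_wigner e he ν hπ σ Φ hΦ hσΦ L hL hL'

omit [FiniteDimensional ℂ K] in
include hΦ hL' in
theorem contMDiff_rep_section_symm : ContMDiff (𝓘(ℝ, EM).prod 𝓘(ℝ, K)) 𝓘(ℝ, K) ∞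
    fun p : (H ⧸ littleGroup N H ν) × K => (Φ (L p.1)).symm p.2 := by
  simp only [rep_symm_apply]
  exact ContMDiff.complex_clm_apply (hΦ.comp (hL'.comp contMDiff_fst).inv) contMDiff_snd

/-- The fiber `Φ(L(q)) H_σ` of the perception bundle. -/
def perceptionFiber (Hσ : Submodule ℂ K) (q : H ⧸ littleGroup N H ν) : Submodule ℂ K :=
  Hσ.map (Φ (L q)).toLinearMap

/-- The perception bundle. -/
def perceptionBundle : HermitianGBundle EG EM (baseAction ν e.toEquiv he) K where
  rank := Module.finrank ℂ Hσ
  fiber := perceptionFiber ν Φ L Hσ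
  isSubbundle _ := by
    -- As `L` is global, transporting a basis of `H_σ` gives a frame over the whole base.
    refine ⟨univ, isOpen_univ, mem_univ _, fun i q => Φ (L q) (Module.finBasis ℂ Hσ i), ?_, ?_⟩
    · exact fun i => (ContMDiff.complex_clm_apply (hΦ.comp hL') contMDiff_const).contMDiffOn
    · intro q _
      set b := Module.finBasis ℂ Hσ
      have hb : range (fun i => Φ (L q) (b i)) =
          (Φ (L q)).toLinearMap '' (Hσ.subtype '' range b) := by
        rw [← range_comp, ← range_comp]
        rfl
      constructor
      · exact ((b.linearIndependent.map' Hσ.subtype (Submodule.ker_subtype _))).map'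
          (Φ (L q)).toLinearMap (LinearMap.ker_eq_bot.2 (Φ (L q)).injective)
      · rw [hb, Submodule.span_image, Submodule.span_image, b.span_eq, Submodule.map_top,
          Submodule.range_subtype]
        rfl
  -- The representative `L(q)` gives a formula that is smooth on all of `K`, not only on the fibers;
  -- other representatives are treated in `perceptionBundle_metric`.
  metric q v w := inner ℂ ((Φ (L q)).symm v) ((Φ (L q)).symm w)
  metric_add_left _ _ _ _ _ _ _ := by rw [map_add, inner_add_left]
  metric_smul_left _ _ _ _ _ _ := by rw [map_smul, inner_smul_left]
  metric_conj _ _ _ _ _ := inner_conj_symm _ _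
  metric_pos q _ _ hu :=
    re_inner_self_pos ((map_ne_zero_iff _ (Φ (L q)).symm.injective).2 hu)
  smooth_metric := by
    have h : ContDiff ℝ ∞ fun p : K × K => (inner ℂ p.1 p.2 : ℂ) := contDiff_inner
    have h1 := contMDiff_rep_section_symm ν Φ hΦ L hL'
    refine ContMDiff.contMDiffOn ?_
    exact h.contMDiff.comp (ContMDiff.prodMk_space
      (h1.comp (contMDiff_fst.prodMk (contMDiff_fst.comp contMDiff_snd)))
      (h1.comp (contMDiff_fst.prodMk (contMDiff_snd.comp contMDiff_snd))))
  smooth_base := contMDiff_baseAction e he ν hπ L hL hL'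
  act g p := (baseAction ν e.toEquiv he g p.1, (boostPhase ν e.toEquiv he L g p.1 : ℂ) •
    Φ (projH e.toEquiv he g) p.2)
  act_fst _ _ _ := rfl
  act_mem g p hp := by
    obtain ⟨w, hw, hwp⟩ := hp
    refine (perceptionFiber ν Φ L Hσ (baseAction ν e.toEquiv he g p.1)).smul_mem _ ?_
    refine ⟨σ (wigner L hL (projH e.toEquiv he g) p.1) ⟨w, hw⟩, Subtype.property _, ?_⟩
    rw [← hwp]
    exact rep_section_wigner hσΦ L hL _ _ ⟨w, hw⟩
  act_one p _ := by
    simp only [boostPhase_one, map_one, Circle.coe_one, one_smul]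
    rfl
  act_mul g g' p _ := by
    refine Prod.ext (by simp) ?_
    simp only [boostPhase_mul ν e.toEquiv he L hL, map_mul, map_smul, smul_smul,
      Circle.coe_mul]
    rfl
  act_add _ _ _ _ _ _ := by simp
  act_smul _ _ _ _ _ := by
    simp only [map_smul]
    rw [smul_comm]
  act_isometry g q := by
    rintro _ ⟨u, hu, rfl⟩ _ ⟨v, hv, rfl⟩
    have h : ∀ w : Hσ, (Φ (L (baseAction ν e.toEquiv he g q))).symm
        (Φ (projH e.toEquiv he g) (Φ (L q) w)) =
          (σ (wigner L hL (projH e.toEquiv he g) q) w : K) := fun w => by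
      rw [← rep_section_wigner hσΦ L hL]
      exact (Φ (L (baseAction ν e.toEquiv he g q))).symm_apply_apply _
    rw [map_smul, map_smul, inner_circle_smul]
    refine (congrArg₂ (inner ℂ) (h ⟨u, hu⟩) (h ⟨v, hv⟩)).trans ?_
    rw [← Submodule.coe_inner, LinearIsometryEquiv.inner_map_map, Submodule.coe_inner]
    exact congrArg₂ (inner ℂ) ((Φ (L q)).symm_apply_apply u).symm
      ((Φ (L q)).symm_apply_apply v).symm
  smooth_act := by
    refine ContMDiff.contMDiffOn (ContMDiff.prodMk ?_ (ContMDiff.complex_smul ?_ ?_))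
    · exact (contMDiff_baseAction e he ν hπ L hL hL').comp contMDiff_group_base
    · exact (contMDiff_boostPhase e he ν hν L hL').comp contMDiff_group_base
    · exact ContMDiff.complex_clm_apply (hΦ.comp ((contMDiff_projH e he).comp contMDiff_fst))
        (contMDiff_snd.comp contMDiff_snd)

/-- The bundle isomorphism `A(q, w) = (q, Φ(L(q)) w)`. -/
def boostMap (Hσ : Submodule ℂ K) (p : (H ⧸ littleGroup N H ν) × Hσ) :
    (H ⧸ littleGroup N H ν) × K :=
  (p.1, Φ (L p.1) p.2)

/-- The inverse `(q, v) ↦ (q, Φ(L(q))⁻¹ v)` of the bundle isomorphism. -/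
def boostMapInv (Hσ : Submodule ℂ K) (p : (H ⧸ littleGroup N H ν) × K) :
    (H ⧸ littleGroup N H ν) × Hσ :=
  -- On the perception fiber the vector already lies in `H_σ`; the projection only extends the map
  -- smoothly to all of `K`.
  (p.1, Hσ.orthogonalProjectionOnto ((Φ (L p.1)).symm p.2))

omit [TopologicalSpace G] in
theorem orthogonalProjectionOnto_symm_rep (x : H) (w : Hσ) :
    Hσ.orthogonalProjectionOnto ((Φ x).symm (Φ x w)) = w := by
  rw [ContinuousLinearEquiv.symm_apply_apply,
    Submodule.orthogonalProjectionOnto_mem_subspace_eq_self]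

theorem boostMapInv_boostMap (p : (H ⧸ littleGroup N H ν) × Hσ) :
    boostMapInv ν Φ L Hσ (boostMap ν Φ L Hσ p) = p :=
  Prod.ext rfl (orthogonalProjectionOnto_symm_rep Φ _ _)

omit [FiniteDimensional ℂ K] in
theorem exists_boostMap_eq {p : (H ⧸ littleGroup N H ν) × K}
    (hp : p.2 ∈ perceptionFiber ν Φ L Hσ p.1) : ∃ w : Hσ, boostMap ν Φ L Hσ (p.1, w) = p := by
  obtain ⟨w, hw, hwp⟩ := hp
  exact ⟨⟨w, hw⟩, Prod.ext rfl hwp⟩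

theorem boostMap_boostMapInv {p : (H ⧸ littleGroup N H ν) × K}
    (hp : p.2 ∈ perceptionFiber ν Φ L Hσ p.1) :
    boostMap ν Φ L Hσ (boostMapInv ν Φ L Hσ p) = p := by
  obtain ⟨w, hw⟩ := exists_boostMap_eq ν Φ L hp
  rw [← hw, boostMapInv_boostMap]

theorem perceptionBundle_total :
    (perceptionBundle e he ν hν hπ σ Φ hΦ hσΦ L hL hL').total = range (boostMap ν Φ L Hσ) := by
  ext p
  constructor
  · intro hp
    obtain ⟨w, hw⟩ := exists_boostMap_eq ν Φ L hp
    exact ⟨_, hw⟩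
  · rintro ⟨p, rfl⟩
    exact ⟨p.2, p.2.2, rfl⟩

theorem perceptionBundle_metric (x : H)
    {v w : K} (hv : v ∈ perceptionFiber ν Φ L Hσ (x : H ⧸ littleGroup N H ν))
    (hw : w ∈ perceptionFiber ν Φ L Hσ (x : H ⧸ littleGroup N H ν)) :
    (perceptionBundle e he ν hν hπ σ Φ hΦ hσΦ L hL hL').metric (x : H ⧸ littleGroup N H ν) v w =
      inner ℂ ((Φ x).symm v) ((Φ x).symm w) := by
  obtain ⟨v, hv, rfl⟩ := hv
  obtain ⟨w, hw, rfl⟩ := hw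
  refine (congrArg₂ (inner ℂ) ((Φ (L _)).symm_apply_apply v)
    ((Φ (L _)).symm_apply_apply w)).trans ?_
  exact (inner_rep_symm_section hσΦ L hL x ⟨v, hv⟩ ⟨w, hw⟩).symm

theorem boostMap_isHom : (boostingBundle e he ν hν hπ σ Φ hΦ hσΦ L hL hL').IsHom
    (perceptionBundle e he ν hν hπ σ Φ hΦ hσΦ L hL hL') (boostMap ν Φ L Hσ) where
  mapsTo p _ := ⟨p.2, p.2.2, rfl⟩
  map_base _ _ := rfl
  map_add _ _ _ _ _ := by simp [boostMap]
  map_smul _ _ _ _ := by simp [boostMap]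
  isometry q u _ v _ := congrArg₂ (inner ℂ) ((Φ (L q)).symm_apply_apply (u : K))
    ((Φ (L q)).symm_apply_apply (v : K))
  equivariant g p _ := by
    refine Prod.ext rfl ?_
    have h := rep_section_wigner hσΦ L hL (projH e.toEquiv he g) p.1 p.2
    change Φ (L (projH e.toEquiv he g • p.1)) ((boostPhase ν e.toEquiv he L g p.1 : ℂ) •
      (σ (wigner L hL (projH e.toEquiv he g) p.1) p.2 : K)) =
        (boostPhase ν e.toEquiv he L g p.1 : ℂ) • Φ (projH e.toEquiv he g) (Φ (L p.1) p.2)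
    rw [map_smul, h]
  smooth := by
    refine ContMDiff.contMDiffOn (contMDiff_fst.prodMk
      (ContMDiff.complex_clm_apply (hΦ.comp (hL'.comp contMDiff_fst)) ?_))
    exact (contDiff_complex_clm Hσ.subtypeL).contMDiff.comp contMDiff_snd

/-- Isometry and equivariance are inherited from `boostMap`, since every point of the perception
bundle is in its range. -/
theorem boostMapInv_isHom : (perceptionBundle e he ν hν hπ σ Φ hΦ hσΦ L hL hL').IsHom
    (boostingBundle e he ν hν hπ σ Φ hΦ hσΦ L hL hL') (boostMapInv ν Φ L Hσ) where
  mapsTo _ _ := trivial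
  map_base _ _ := rfl
  map_add _ _ _ _ _ := by simp [boostMapInv]
  map_smul _ _ _ _ := by simp [boostMapInv]
  isometry q := by
    rintro _ ⟨u, hu, rfl⟩ _ ⟨v, hv, rfl⟩
    have h := (boostMap_isHom e he ν hν hπ σ Φ hΦ hσΦ L hL hL').isometry q ⟨u, hu⟩ trivial
      ⟨v, hv⟩ trivial
    refine Eq.trans ?_ h.symm
    exact congrArg₂ (inner ℂ) (orthogonalProjectionOnto_symm_rep Φ _ ⟨u, hu⟩)
      (orthogonalProjectionOnto_symm_rep Φ _ ⟨v, hv⟩)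
  equivariant g p hp := by
    obtain ⟨w, hw⟩ := exists_boostMap_eq ν Φ L hp
    rw [← hw, ← (boostMap_isHom e he ν hν hπ σ Φ hΦ hσΦ L hL hL').equivariant g (p.1, w) trivial,
      boostMapInv_boostMap, boostMapInv_boostMap]
  smooth := by
    refine ContMDiff.contMDiffOn (contMDiff_fst.prodMk ?_)
    exact (contDiff_complex_clm Hσ.orthogonalProjectionOnto).contMDiff.comp
      (contMDiff_rep_section_symm ν Φ hΦ L hL')

theorem boostMap_isIso : (boostingBundle e he ν hν hπ σ Φ hΦ hσΦ L hL hL').IsIso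
    (perceptionBundle e he ν hν hπ σ Φ hΦ hσΦ L hL hL') (boostMap ν Φ L Hσ) :=
  ⟨boostMap_isHom e he ν hν hπ σ Φ hΦ hσΦ L hL hL', boostMapInv ν Φ L Hσ,
    boostMapInv_isHom e he ν hν hπ σ Φ hΦ hσΦ L hL hL',
    fun _ _ => boostMapInv_boostMap ν Φ L _, fun _ hp => boostMap_boostMapInv ν Φ L hp⟩

end Bundles

/-- A surjective isometry from a seminormed space onto a normed space identifies the separation
quotient of the former with the latter. -/
def separationQuotientEquivOfSurjective {E F : Type*} [SeminormedAddCommGroup E]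
    [InnerProductSpace ℂ E] [NormedAddCommGroup F] [InnerProductSpace ℂ F] (J : E →ₗᵢ[ℂ] F)
    (hJ : Surjective J) : SeparationQuotient E ≃ₗᵢ[ℂ] F :=
  LinearIsometryEquiv.ofSurjective
    { toFun := SeparationQuotient.lift J fun _ _ h => (h.map J.continuous).eq
      map_add' := by
        rintro ⟨f⟩ ⟨f'⟩
        exact J.map_add f f'
      map_smul' := by
        rintro c ⟨f⟩
        exact J.map_smul c f
      norm_map' := by
        rintro ⟨f⟩
        exact J.norm_map f }
    fun y => by
      obtain ⟨f, hf⟩ := hJ y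
      exact ⟨SeparationQuotient.mk f, hf⟩

/-! ### The identification of `L² ⊗ V` with `L²(V)`. -/

section LpTensor

variable {M V : Type*} [MeasurableSpace M] (μ : Measure M)
  [NormedAddCommGroup V] [InnerProductSpace ℂ V]

/-- The linear map `L² ⊗ V → L²(V)`, `f ⊗ v ↦ (q ↦ f(q) v)`. -/
def lpTensorMap : (Lp ℂ 2 μ) ⊗[ℂ] V →ₗ[ℂ] Lp V 2 μ :=
  TensorProduct.lift (LinearMap.mk₂ ℂ
    (fun (f : Lp ℂ 2 μ) (v : V) => (ContinuousLinearMap.toSpanSingleton ℂ v).compLp f)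
    (fun f f' v => map_add (ContinuousLinearMap.compLpL 2 μ
      (ContinuousLinearMap.toSpanSingleton ℂ v)) f f')
    (fun c f v => map_smul (ContinuousLinearMap.compLpL 2 μ
      (ContinuousLinearMap.toSpanSingleton ℂ v)) c f)
    (fun f v v' => by
      rw [ContinuousLinearMap.toSpanSingleton_add, ContinuousLinearMap.add_compLp])
    (fun c f v => by
      rw [ContinuousLinearMap.toSpanSingleton_smul, ContinuousLinearMap.smul_compLp]))

theorem coeFn_lpTensorMap_tmul (f : Lp ℂ 2 μ) (v : V) :
    lpTensorMap μ (f ⊗ₜ[ℂ] v) =ᵐ[μ] fun q => f q • v :=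
  (ContinuousLinearMap.toSpanSingleton ℂ v).coeFn_compLp f

theorem inner_lpTensorMap (x y : (Lp ℂ 2 μ) ⊗[ℂ] V) :
    inner ℂ (lpTensorMap μ x) (lpTensorMap μ y) = inner ℂ x y := by
  induction x with
  | zero => simp
  | add x x' hx hx' => rw [map_add, inner_add_left, inner_add_left, hx, hx']
  | tmul f v =>
    induction y with
    | zero => simp
    | add y y' hy hy' => rw [map_add, inner_add_right, inner_add_right, hy, hy']
    | tmul f' v' =>
      rw [TensorProduct.inner_tmul, L2.inner_def, L2.inner_def, ← integral_mul_const]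
      refine integral_congr_ae ?_
      filter_upwards [coeFn_lpTensorMap_tmul μ f v, coeFn_lpTensorMap_tmul μ f' v'] with q h h'
      rw [h, h', inner_smul_left, inner_smul_right]
      simp only [RCLike.inner_apply]
      ring

/-- Expand the values in an orthonormal basis, `ψ = ∑ ⟨bᵢ, ψ⟩ bᵢ`. The sum is finite, so the
algebraic tensor product needs no completion. -/
theorem lpTensorMap_surjective [FiniteDimensional ℂ V] :
    Surjective (lpTensorMap (V := V) μ) := by
  intro ψ
  let b := stdOrthonormalBasis ℂ V
  refine ⟨∑ i, ((innerSL ℂ (b i)).compLp ψ) ⊗ₜ[ℂ] b i, ?_⟩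
  rw [map_sum]
  apply Lp.ext
  refine (Lp.coeFn_finsetSum _ _).trans ?_
  have h1 : ∀ᵐ q ∂μ, ∀ i, lpTensorMap μ (((innerSL ℂ (b i)).compLp ψ) ⊗ₜ[ℂ] b i) q =
      ((innerSL ℂ (b i)).compLp ψ) q • b i :=
    ae_all_iff.2 fun i => coeFn_lpTensorMap_tmul μ _ _
  have h2 : ∀ᵐ q ∂μ, ∀ i, ((innerSL ℂ (b i)).compLp ψ) q = innerSL ℂ (b i) (ψ q) :=
    ae_all_iff.2 fun i => (innerSL ℂ (b i)).coeFn_compLp ψ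
  filter_upwards [h1, h2] with q h1 h2
  simp only [Finset.sum_apply, h1, h2, innerSL_apply_apply]
  exact b.sum_repr' (ψ q)

/-- The unitary operator `L² ⊗ V ≃ L²(V)` for a finite-dimensional space `V`. -/
def lpTensorEquiv [FiniteDimensional ℂ V] : (Lp ℂ 2 μ) ⊗[ℂ] V ≃ₗᵢ[ℂ] Lp V 2 μ :=
  LinearIsometryEquiv.ofSurjective
    (LinearMap.isometryOfInner (lpTensorMap (V := V) μ) (inner_lpTensorMap μ))
    (lpTensorMap_surjective (V := V) μ)

end LpTensor

/-! ### Bundle isomorphisms and the representation of a product bundle. -/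

namespace HermitianGBundle

variable {EG EM : Type*} {G M : Type*} [Group G] [TopologicalSpace G]
    [NormedAddCommGroup EG] [NormedSpace ℝ EG] [ChartedSpace EG G]
    [TopologicalSpace M] [NormedAddCommGroup EM] [NormedSpace ℝ EM] [ChartedSpace EM M]
    {l : G →* Equiv.Perm M}

section Map

variable {K : Type*} [NormedAddCommGroup K] [NormedSpace ℂ K]
    {K' : Type*} [NormedAddCommGroup K'] [NormedSpace ℂ K']
    {E : HermitianGBundle EG EM l K} {E' : HermitianGBundle EG EM l K'}
    {A : M × K → M × K'} {B : M × K' → M × K}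

theorem IsHom.apply_eq (hA : E.IsHom E' A) {x : M} {v : K} (hv : v ∈ E.fiber x) :
    A (x, v) = (x, (A (x, v)).2) :=
  Prod.ext (hA.map_base (x, v) hv) rfl

variable [MeasurableSpace M] [OpensMeasurableSpace M]
    [FiniteDimensional ℂ K] [MeasurableSpace K] [BorelSpace K]
    [FiniteDimensional ℂ K'] [MeasurableSpace K'] [BorelSpace K']

/-- Composition of Borel sections with a homomorphism of Hermitian `G`-bundles. -/
def IsHom.mapSections (hA : E.IsHom E' A) : E.borelSections →ₗ[ℂ] E'.borelSections where
  toFun ψ := ⟨fun x => (A (x, ψ.1 x)).2, by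
      have := secondCountable_of_finiteDimensional K
      exact measurable_comp_of_continuousOn
        (continuous_snd.comp_continuousOn hA.smooth.continuousOn)
        (measurable_id.prodMk ψ.2.1) fun x => ψ.2.2 x, fun x => by
      have h : A (x, ψ.1 x) ∈ E'.total := hA.mapsTo (ψ.2.2 x : (x, ψ.1 x) ∈ E.total)
      rw [hA.apply_eq (ψ.2.2 x)] at h
      exact h⟩
  map_add' ψ φ := Subtype.ext (funext fun x => hA.map_add x _ (ψ.2.2 x) _ (φ.2.2 x))
  map_smul' c ψ := Subtype.ext (funext fun x => hA.map_smul x c _ (ψ.2.2 x))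

theorem IsHom.mapSections_mapSections (hA : E.IsHom E' A) (hB : E'.IsHom E B)
    (h : LeftInvOn B A E.total) (ψ : E.borelSections) :
    hB.mapSections (hA.mapSections ψ) = ψ := by
  refine Subtype.ext (funext fun x => ?_)
  change (B (x, (A (x, ψ.1 x)).2)).2 = ψ.1 x
  rw [← hA.apply_eq (ψ.2.2 x), h (ψ.2.2 x : (x, ψ.1 x) ∈ E.total)]

/-- Composition with an isomorphism of Hermitian `G`-bundles, as an equivalence of the spaces of
Borel sections. -/
def IsHom.sectionsEquiv (hA : E.IsHom E' A) (hB : E'.IsHom E B) (h : InvOn B A E.total E'.total) :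
    E.borelSections ≃ₗ[ℂ] E'.borelSections where
  toLinearMap := hA.mapSections
  invFun := hB.mapSections
  left_inv := hA.mapSections_mapSections hB h.1
  right_inv := hB.mapSections_mapSections hA h.2

/-- Composition with an isomorphism of Hermitian `G`-bundles is a unitary operator which intertwines
the associated induced representations. -/
theorem IsIso.exists_intertwines (hA : E.IsIso E' A) (μ : Measure M)
    (hμ : ∀ g, MeasurePreserving (l g) μ μ) :
    ∃ T : E.L2 μ ≃ₗᵢ[ℂ] E'.L2 μ, Intertwines (E.inducedRep μ hμ) (E'.inducedRep μ hμ) T ∧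
      ∀ ψ : E.PreL2 μ, ∃ φ : E'.PreL2 μ,
        (∀ q, (q, sec φ q) = A (q, sec ψ q)) ∧ T (cls ψ) = cls φ := by
  obtain ⟨hA, B, hB, hAB⟩ := hA
  have hT : ∀ x f f', E'.formField.form (id x) (hA.sectionsEquiv hB hAB f)
      (hA.sectionsEquiv hB hAB f') = E.formField.form x f f' := fun x f f' =>
    hA.isometry x _ (f.2.2 x) _ (f'.2.2 x)
  refine ⟨FormField.l2Equiv (MeasurePreserving.id μ) (hA.sectionsEquiv hB hAB) hT,
    FormField.l2Equiv_intertwines _ _ _ _ _ _ _ fun g ψ => ?_, fun ψ =>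
      ⟨FormField.preL2Equiv (MeasurePreserving.id μ) (hA.sectionsEquiv hB hAB) hT ψ,
        fun q => (hA.apply_eq (ψ.val.2.2 q)).symm, rfl⟩⟩
  refine Subtype.ext (funext fun x => ?_)
  change (A (x, (E.act g (l g⁻¹ x, ψ.1 (l g⁻¹ x))).2)).2 =
    (E'.act g (l g⁻¹ x, (A (l g⁻¹ x, ψ.1 (l g⁻¹ x))).2)).2
  have hp : ((l g⁻¹ x, ψ.1 (l g⁻¹ x)) : M × K) ∈ E.total := ψ.2.2 _
  rw [← hA.apply_eq (ψ.2.2 _), ← hA.equivariant g _ hp]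
  congr 2
  refine Prod.ext ?_ rfl
  rw [E.act_fst g _ hp]
  simp

end Map

section Trivial

variable {V : Type*} [NormedAddCommGroup V] [InnerProductSpace ℂ V]
    {E : HermitianGBundle EG EM l V} (hfib : ∀ q, E.fiber q = ⊤)
    (hmet : ∀ q v w, E.metric q v w = inner ℂ v w)

include hfib in
theorem continuous_act_of_trivial :
    Continuous fun p : G × (M × V) => E.act p.1 p.2 := by
  have h : (univ : Set G) ×ˢ totalSpace E.fiber = univ := by
    ext p
    simp [totalSpace, hfib]
  have h1 := E.smooth_act.continuousOn
  rwa [h, continuousOn_univ] at h1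

variable [FiniteDimensional ℂ V] [MeasurableSpace V] [BorelSpace V]
    [MeasurableSpace M] [OpensMeasurableSpace M] (μ : Measure M)

include hmet in
theorem form_eq_inner (q : M) (ψ φ : E.borelSections) :
    E.formField.form q ψ φ = inner ℂ (ψ.1 q) (φ.1 q) := hmet q _ _

include hmet in
theorem sqIntegrable_iff_memLp (ψ : E.borelSections) :
    E.formField.SqIntegrable μ ψ ↔ MemLp ψ.1 2 μ := by
  have := secondCountable_of_finiteDimensional V
  have h : ∀ q, (E.formField.form q ψ ψ).re = ‖ψ.1 q‖ ^ 2 := fun q => by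
    rw [form_eq_inner hmet]
    exact inner_self_eq_norm_sq (𝕜 := ℂ) _
  rw [memLp_two_iff_integrable_sq_norm ψ.2.1.aestronglyMeasurable]
  constructor
  · intro hψ
    simpa only [h] using hψ.integrable_re
  · intro hψ
    have h1 := hψ.2
    rw [hasFiniteIntegral_iff_ofReal (Filter.Eventually.of_forall fun q => by positivity)] at h1
    simpa only [FormField.SqIntegrable, h] using h1

/-- The isometry from the square-integrable sections of a product bundle onto `L²(V)`. -/
def toLpIsometry : E.PreL2 μ →ₗᵢ[ℂ] Lp V 2 μ where
  toFun ψ := ((sqIntegrable_iff_memLp hmet μ ψ.val).1 ψ.property).toLp _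
  map_add' _ _ := rfl
  map_smul' _ _ := rfl
  norm_map' ψ := by
    rw [@norm_eq_sqrt_re_inner ℂ, @norm_eq_sqrt_re_inner ℂ _ _ _ _ ψ]
    congr 2
    have hψ := (sqIntegrable_iff_memLp hmet μ ψ.val).1 ψ.property
    change inner ℂ (hψ.toLp ψ.val.1) (hψ.toLp ψ.val.1) = _
    rw [FormField.PreL2.inner_def, L2.inner_def]
    refine integral_congr_ae ?_
    filter_upwards [hψ.coeFn_toLp] with q hq
    rw [hq, form_eq_inner hmet]

/-- A measurable square-integrable function, as a section of the product bundle. -/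
def sectionOfMemLp {f : M → V} (hf : Measurable f) (hf2 : MemLp f 2 μ) : E.PreL2 μ :=
  ⟨⟨f, hf, fun q => by rw [hfib]; trivial⟩, (sqIntegrable_iff_memLp hmet μ _).2 hf2⟩

-- Sections are Borel on the nose, not just almost everywhere; an `L²` class has a strongly
-- measurable representative, which is such a section.
include hfib in
theorem toLpIsometry_surjective : Surjective (toLpIsometry hmet μ) := fun f =>
  ⟨sectionOfMemLp hfib hmet μ (Lp.stronglyMeasurable f).measurable (Lp.memLp f),
    Lp.toLp_coeFn f (Lp.memLp f)⟩

/-- The space of square-integrable sections of a product bundle is `L²(V)`. -/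
def l2EquivLp : E.L2 μ ≃ₗᵢ[ℂ] Lp V 2 μ :=
  separationQuotientEquivOfSurjective (toLpIsometry hmet μ) (toLpIsometry_surjective hfib hmet μ)

include hfib hmet in
/-- The space of square-integrable sections of a product bundle is `L² ⊗ V`. -/
theorem exists_tensor_equiv : ∃ T : (Lp ℂ 2 μ) ⊗[ℂ] V ≃ₗᵢ[ℂ] E.L2 μ,
    ∀ (f : Lp ℂ 2 μ) (v : V), ∃ ψ : E.PreL2 μ,
      (∀ᵐ q ∂μ, sec ψ q = f q • v) ∧ T (f ⊗ₜ[ℂ] v) = cls ψ := by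
  refine ⟨(lpTensorEquiv μ).trans (l2EquivLp hfib hmet μ).symm, fun f v => ?_⟩
  obtain ⟨ψ, hψ⟩ := toLpIsometry_surjective hfib hmet μ (lpTensorMap μ (f ⊗ₜ[ℂ] v))
  refine ⟨ψ, ?_, ?_⟩
  · filter_upwards [((sqIntegrable_iff_memLp hmet μ ψ.val).1 ψ.property).coeFn_toLp,
      coeFn_lpTensorMap_tmul μ f v] with q h1 h2
    rw [← h2, ← hψ]
    exact h1.symm
  · rw [LinearIsometryEquiv.trans_apply, LinearIsometryEquiv.symm_apply_eq]
    exact hψ.symm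

variable (hμ : ∀ g, MeasurePreserving (l g) μ μ)

include hmet in
theorem norm_cls_sub_sq (ψ φ : E.PreL2 μ) :
    ‖cls ψ - cls φ‖ ^ 2 = ∫ q, ‖sec ψ q - sec φ q‖ ^ 2 ∂μ := by
  change ‖ψ - φ‖ ^ 2 = _
  have h := inner_self_eq_norm_sq (𝕜 := ℂ) (ψ - φ)
  rw [← h, FormField.PreL2.inner_def]
  have hi := (ψ - φ).property.integrable (ψ - φ).property
  refine (integral_re hi).symm.trans (integral_congr_ae (Filter.Eventually.of_forall fun q => ?_))
  change RCLike.re (E.formField.form q (ψ - φ).val (ψ - φ).val) = _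
  rw [form_eq_inner hmet, inner_self_eq_norm_sq]
  rfl

theorem inducedRep_cls (g : G) (ψ : E.PreL2 μ) : ∃ φ : E.PreL2 μ,
    E.inducedRep μ hμ g (cls ψ) = cls φ ∧
      ∀ q, sec φ q = (E.act g (l g⁻¹ q, sec ψ (l g⁻¹ q))).2 :=
  ⟨_, rfl, fun _ => rfl⟩

variable [IsTopologicalGroup G] [LocallyCompactSpace G] [IsFiniteMeasureOnCompacts μ]

-- For `g` in a compact neighborhood of the identity, the integrands of `‖U(g)ψ - ψ‖²` are jointly
-- continuous and supported in one compact set, so the integral is continuous in `g`; at the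
-- identity it vanishes.
include hfib hmet in
theorem continuousAt_inducedRep_of_hasCompactSupport (ψ : E.PreL2 μ) (hc : Continuous (sec ψ))
    (hs : HasCompactSupport (sec ψ)) :
    ContinuousAt (fun g => E.inducedRep μ hμ g (cls ψ)) 1 := by
  obtain ⟨C, hC, hC1⟩ := exists_compact_mem_nhds (1 : G)
  have hbase : Continuous fun p : G × M => l p.1 p.2 := E.smooth_base.continuous
  have hbase' : Continuous fun p : G × M => l p.1⁻¹ p.2 :=
    hbase.comp ((continuous_fst.inv).prodMk continuous_snd)
  let F : G → M → ℝ := fun g q =>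
    ‖(E.act g (l g⁻¹ q, sec ψ (l g⁻¹ q))).2 - sec ψ q‖ ^ 2
  -- The action fixes the zero section, so the translated section vanishes wherever `ψ(g⁻¹q)` does.
  have hact0 : ∀ g q, (E.act g (q, 0)).2 = 0 := fun g q => by
    have := E.act_smul g q 0 0 (zero_mem _)
    simpa using this
  have hFc : Continuous (uncurry F) := by
    have h1 : Continuous fun p : G × M => E.act p.1 (l p.1⁻¹ p.2, sec ψ (l p.1⁻¹ p.2)) :=
      (continuous_act_of_trivial hfib).comp
        (continuous_fst.prodMk (hbase'.prodMk (hc.comp hbase')))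
    exact ((continuous_snd.comp h1).sub (hc.comp continuous_snd)).norm.pow 2
  -- `C · supp ψ` contains the supports of all translates by elements of `C`, and `supp ψ` accounts
  -- for the subtracted term.
  have hk : IsCompact
      ((fun p : G × M => l p.1 p.2) '' (C ×ˢ tsupport (sec ψ)) ∪ tsupport (sec ψ)) :=
    ((hC.prod hs).image hbase).union hs
  have h0 : ∀ g q, g ∈ C → q ∉ (fun p : G × M => l p.1 p.2) '' (C ×ˢ tsupport (sec ψ)) ∪
      tsupport (sec ψ) → F g q = 0 := fun g q hg hq => by
    have h2 : sec ψ q = 0 := image_eq_zero_of_notMem_tsupport fun h => hq (Or.inr h)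
    have h1 : sec ψ (l g⁻¹ q) = 0 := image_eq_zero_of_notMem_tsupport fun h =>
      hq (Or.inl ⟨(g, l g⁻¹ q), ⟨hg, h⟩, by simp⟩)
    simp only [F, h1, h2, hact0, sub_zero, norm_zero]
    norm_num
  have hI : ContinuousAt (fun g => ∫ q, F g q ∂μ) 1 :=
    (continuousOn_integral_of_compact_support hk hFc.continuousOn h0).continuousAt hC1
  have hF1 : ∀ q, F 1 q = 0 := fun q => by
    have := E.act_one (q, sec ψ q) (by simp [totalSpace, hfib])
    simp [F, -map_inv, this]
  have hN : ∀ g, dist (E.inducedRep μ hμ g (cls ψ)) (E.inducedRep μ hμ 1 (cls ψ)) =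
      √(∫ q, F g q ∂μ) := fun g => by
    obtain ⟨φ, hφ, hφ'⟩ := inducedRep_cls μ hμ g ψ
    have h1 : E.inducedRep μ hμ 1 (cls ψ) = cls ψ := by
      rw [map_one]
      rfl
    rw [h1, hφ, dist_eq_norm, ← Real.sqrt_sq (norm_nonneg (cls φ - cls ψ)), norm_cls_sub_sq hmet]
    simp only [hφ', F]
  rw [ContinuousAt, tendsto_iff_dist_tendsto_zero]
  simp only [hN]
  have h3 : ContinuousAt (fun g => √(∫ q, F g q ∂μ)) 1 :=
    Real.continuous_sqrt.continuousAt.comp hI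
  simpa [ContinuousAt, hF1] using h3

variable [BorelSpace M] [T2Space M] [LocallyCompactSpace M] [SecondCountableTopology M]

omit [IsTopologicalGroup G] [LocallyCompactSpace G] in
include hfib hmet in
theorem dense_cls_hasCompactSupport :
    Dense {x : E.L2 μ | ∃ ψ : E.PreL2 μ, Continuous (sec ψ) ∧ HasCompactSupport (sec ψ) ∧
      cls ψ = x} := by
  have := secondCountable_of_finiteDimensional V
  -- Approximation by compactly supported continuous functions rests on regularity of `μ`; a locally
  -- finite measure on a σ-compact metrizable space is regular.
  have := TopologicalSpace.metrizableSpace_of_t3_secondCountable M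
  intro x
  obtain ⟨ψ, rfl⟩ := SeparationQuotient.surjective_mk x
  refine Metric.mem_closure_iff.2 fun ε hε => ?_
  have hψ := (sqIntegrable_iff_memLp hmet μ ψ.val).1 ψ.property
  -- The approximation bound is not strict, hence `ε / 2`.
  obtain ⟨f, hfs, hfe, hfc, hf2⟩ := hψ.exists_hasCompactSupport_eLpNorm_sub_le
    (by simp) (ε := ENNReal.ofReal (ε / 2)) (by simpa using hε)
  let φ : E.PreL2 μ := sectionOfMemLp hfib hmet μ hfc.measurable hf2
  refine ⟨cls φ, ⟨φ, hfc, hfs, rfl⟩, ?_⟩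
  have h1 : dist (cls ψ) (cls φ) = dist (toLpIsometry hmet μ ψ) (toLpIsometry hmet μ φ) :=
    ((toLpIsometry hmet μ).dist_map ψ φ).symm
  change dist (cls ψ) (cls φ) < ε
  rw [h1]
  change dist (hψ.toLp _) (hf2.toLp _) < ε
  rw [Lp.dist_def]
  have h2 : eLpNorm (⇑(hψ.toLp ψ.val.1) - ⇑(hf2.toLp f)) 2 μ = eLpNorm (ψ.val.1 - f) 2 μ :=
    eLpNorm_congr_ae (hψ.coeFn_toLp.sub hf2.coeFn_toLp)
  rw [h2]
  refine (ENNReal.toReal_le_of_le_ofReal (by positivity) hfe).trans_lt (by linarith)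

include hfib hmet in
/-- The induced representation of a product bundle with constant metric is a strongly continuous
unitary representation on a Hilbert space. -/
theorem isUnitaryRepresentation_of_trivial :
    IsUnitaryRepresentation (E.inducedRep μ hμ) := by
  refine ⟨?_, continuous_orbit_of_dense (dense_cls_hasCompactSupport hfib hmet μ) ?_⟩
  · let T := l2EquivLp hfib hmet μ
    exact (completeSpace_congr T.isometry.isUniformInducing.isUniformEmbedding
      (e := T.toEquiv)).2 inferInstance
  · rintro _ ⟨ψ, hc, hs, rfl⟩
    exact continuousAt_inducedRep_of_hasCompactSupport hfib hmet μ hμ ψ hc hs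

end Trivial

end HermitianGBundle

/-! ### The equivalence with the Mackey induced representation. -/

section InducedEquivalence

variable {G : Type*} [Group G] [TopologicalSpace G] {N H : Subgroup G} [N.Normal]
  [IsMulCommutative N] (ν : PontryaginDual N)
  (e : N × H ≃ G) (he : ∀ n h, e (n, h) = (n : G) * h)
  {V : Type*} [NormedAddCommGroup V] [InnerProductSpace ℂ V]
  (σ : littleGroup N H ν →* (V ≃ₗᵢ[ℂ] V))
  (L : H ⧸ littleGroup N H ν → H) (hL : ∀ q, ((L q : H) : H ⧸ littleGroup N H ν) = q)

omit [TopologicalSpace G] [IsMulCommutative N] in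
theorem inv_mul_mul_eq_conjInv_mul (a x g : G) :
    a⁻¹ * g * x = (conjInv N a (e.symm g).1 : G) * (a⁻¹ * (projH e he g : G) * x) := by
  conv_lhs => rw [semidirect_eq e he g]
  simp [conjInv, projH, mul_assoc]

include he hL in
theorem section_inv_mul_mul_mem (g : G) (q : H ⧸ littleGroup N H ν) :
    ((L (baseAction ν e he g q) : H) : G)⁻¹ * g * L q ∈ isotropy N ν := by
  rw [inv_mul_mul_eq_conjInv_mul e he]
  exact mul_mem (le_isotropy ν (Subtype.property _)) (wigner L hL (projH e he g) q).2

/-- The bridge between the two pictures: the boosting action is `νσ` of the single cocycle `L(gq)⁻¹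
g L(q)`. -/
theorem nuSigma_section (g : G) (q : H ⧸ littleGroup N H ν) (v : V) :
    nuSigma ν e he σ ⟨_, section_inv_mul_mul_mem ν e he L hL g q⟩ v =
      (boostPhase ν e he L g q : ℂ) • σ (wigner L hL (projH e he g) q) v := by
  have h : e.symm (((L (baseAction ν e he g q) : H) : G)⁻¹ * g * L q) =
      (conjInv N (L (baseAction ν e he g q) : G) (e.symm g).1,
        (wigner L hL (projH e he g) q).1) := by
    rw [inv_mul_mul_eq_conjInv_mul e he]
    exact symm_mul e he _ (wigner L hL (projH e he g) q).1
  have h1 : ν (e.symm (((L (baseAction ν e he g q) : H) : G)⁻¹ * g * L q)).1 =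
      boostPhase ν e he L g q := by
    -- The `N`-component is conjugated by `L(gq)`; inserting the Wigner element, which fixes `ν`,
    -- replaces this by `L(gq) W_L(h, q) = h L(q)`.
    rw [h, boostPhase, ← character_conjInv_mul ν (wigner L hL (projH e he g) q).2,
      ← Subgroup.coe_mul, ← Subgroup.coe_mul]
    congr 3
    exact (section_mul_wigner L hL (projH e he g) q)
  have h2 : (⟨(e.symm (((L (baseAction ν e he g q) : H) : G)⁻¹ * g * L q)).2, projH_mem ν e he
      (section_inv_mul_mul_mem ν e he L hL g q)⟩ : littleGroup N H ν) =
        wigner L hL (projH e he g) q := Subtype.ext (congrArg Prod.snd h)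
  rw [← h1, ← h2]
  rfl

/-- The coset of the `H`-component of `g`. -/
def cosetH (g : G) : H ⧸ littleGroup N H ν := (projH e he g : H)

omit [IsMulCommutative N] in
theorem cosetH_coe (h : H) : cosetH ν e he (h : G) = (h : H ⧸ littleGroup N H ν) := by
  have h1 := projH_mul_coe e he 1 h
  rw [Subgroup.coe_one, one_mul] at h1
  rw [cosetH, h1]

omit [IsMulCommutative N] in
theorem cosetH_section (q : H ⧸ littleGroup N H ν) (hq : ((L q : H) : H ⧸ littleGroup N H ν) = q) :
    cosetH ν e he (L q : G) = q := by
  rw [cosetH_coe, hq]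

theorem cosetH_mul (g : G) (s : isotropy N ν) : cosetH ν e he (g * s) = cosetH ν e he g := by
  unfold cosetH
  rw [map_mul]
  exact (QuotientGroup.mk_mul_of_mem _ (projH_mem ν e he s.2))

omit [IsMulCommutative N] in
theorem baseAction_inv_cosetH (g : G) : baseAction ν e he g⁻¹ (cosetH ν e he g) = (1 : H) := by
  change ((projH e he g⁻¹ * projH e he g : H) : H ⧸ littleGroup N H ν) = _
  rw [← map_mul, inv_mul_cancel, map_one]

include hL in
theorem section_cosetH_inv_mul_mem (g : G) : (L (cosetH ν e he g) : G)⁻¹ * g ∈ isotropy N ν := by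
  have h := inv_mul_mul_eq_conjInv_mul (N := N) e he (L (cosetH ν e he g) : G) 1 g
  rw [mul_one, mul_one] at h
  rw [h]
  exact mul_mem (le_isotropy ν (Subtype.property _)) (section_inv_mul_mem L hL (projH e he g))

/-- The element `L(q)⁻¹ g` of the isotropy group, where `q` is the coset of `g`. -/
def isotropyPart (g : G) : isotropy N ν :=
  ⟨(L (cosetH ν e he g) : G)⁻¹ * g, section_cosetH_inv_mul_mem ν e he L hL g⟩

theorem section_mul_isotropyPart (g : G) :
    (L (cosetH ν e he g) : G) * isotropyPart ν e he L hL g = g := by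
  simp [isotropyPart]

theorem isotropyPart_mul (g : G) (s : isotropy N ν) :
    isotropyPart ν e he L hL (g * s) = isotropyPart ν e he L hL g * s :=
  Subtype.ext (by simp [isotropyPart, cosetH_mul, mul_assoc])

theorem isotropyPart_section (q : H ⧸ littleGroup N H ν) :
    isotropyPart ν e he L hL (L q : G) = 1 :=
  Subtype.ext (by simp [isotropyPart, cosetH_section ν e he L q (hL q)])

/-- Since `g⁻¹` moves the coset of `g` to the base point, `(L(q)⁻¹ g)⁻¹` is `L(H_ν)` times the
cocycle at `(g⁻¹, q)`. All dependence on `g` thus goes through the bundle action, whose continuity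
then gives measurability in `g`. -/
theorem nuSigma_isotropyPart_inv (g : G) (v : V) :
    (nuSigma ν e he σ (isotropyPart ν e he L hL g))⁻¹ v =
      nuSigma ν e he σ (isotropyPart ν e he L hL 1)⁻¹
        ((boostPhase ν e he L g⁻¹ (cosetH ν e he g) : ℂ) •
          σ (wigner L hL (projH e he g⁻¹) (cosetH ν e he g)) v) := by
  rw [← nuSigma_section, ← map_inv]
  change _ = (nuSigma ν e he σ _ * nuSigma ν e he σ _) v
  rw [← map_mul]
  congr 2
  refine Subtype.ext ?_
  have h1 : cosetH ν e he (1 : G) = (1 : H) := by rw [cosetH, map_one]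
  simp [isotropyPart, baseAction_inv_cosetH, h1, mul_assoc, -map_inv]

variable [IsTopologicalGroup G] [MeasurableSpace G] [BorelSpace G]
  [FiniteDimensional ℂ V] [MeasurableSpace V] [BorelSpace V]
  {EG EM : Type*} [NormedAddCommGroup EG] [NormedSpace ℝ EG] [ChartedSpace EG G]
  [NormedAddCommGroup EM] [NormedSpace ℝ EM] [ChartedSpace EM (H ⧸ littleGroup N H ν)]
  [SecondCountableTopology G]
  {E : HermitianGBundle EG EM (baseAction ν e he) V} (hfib : ∀ q, E.fiber q = ⊤)
  (hmet : ∀ q v w, E.metric q v w = inner ℂ v w)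
  (hact : ∀ g q v, (E.act g (q, v)).2 =
    (boostPhase ν e he L g q : ℂ) • σ (wigner L hL (projH e he g) q) v)
  (hLc : Continuous L) (hp : Continuous (projH e he))

/-- Restriction along the section `L`, from equivariant functions on `G` to Borel sections of the
boosting bundle. -/
def equivariantFunctionsEquiv :
    equivariantFunctions (isotropy N ν) (nuSigma ν e he σ) ≃ₗ[ℂ] E.borelSections where
  toFun f := ⟨fun q => f.1 (L q : G),
    f.2.1.comp (measurable_subtype_coe.comp hLc.measurable), fun q => by rw [hfib]; trivial⟩
  map_add' _ _ := rfl
  map_smul' _ _ := rfl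
  invFun ψ := ⟨fun g =>
      (nuSigma ν e he σ (isotropyPart ν e he L hL g))⁻¹ (ψ.1 (cosetH ν e he g)), by
      have := secondCountable_of_finiteDimensional V
      have h1 : Measurable (cosetH ν e he) := QuotientGroup.measurable_coe.comp hp.measurable
      -- Now the function is a fixed unitary operator applied to the continuous action of `g⁻¹` on
      -- `(q, ψ(q))`.
      simp only [nuSigma_isotropyPart_inv, ← hact]
      refine (LinearIsometryEquiv.continuous _).measurable.comp ?_
      have h2 : Measurable fun g : G => (g⁻¹, cosetH ν e he g, ψ.1 (cosetH ν e he g)) :=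
        measurable_inv.prodMk (h1.prodMk (ψ.2.1.comp h1))
      exact (continuous_snd.comp
        (HermitianGBundle.continuous_act_of_trivial hfib)).measurable.comp h2,
    fun g s => by
      beta_reduce
      rw [isotropyPart_mul, cosetH_mul, map_mul, mul_inv_rev]
      rfl⟩
  left_inv f := by
    refine Subtype.ext (funext fun g => ?_)
    change (nuSigma ν e he σ _)⁻¹ (f.1 _) = f.1 g
    rw [← f.2.2, section_mul_isotropyPart]
  right_inv ψ := by
    refine Subtype.ext (funext fun q => ?_)
    change (nuSigma ν e he σ _)⁻¹ (ψ.1 _) = ψ.1 q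
    rw [isotropyPart_section, cosetH_section ν e he L q (hL q), map_one, inv_one]
    rfl

include hmet hact hfib hLc hp in
/-- `Ind νσ` is unitarily equivalent to the representation of the boosting bundle. -/
theorem unitarilyEquivalent_ind (μ : Measure (H ⧸ littleGroup N H ν))
    (hμ : ∀ g, MeasurePreserving (baseAction ν e he g) μ μ)
    (hμ' : ∀ g, MeasurePreserving (MulAction.toPermHom G (G ⧸ isotropy N ν) g)
      (μ.map (iota N H ν)) (μ.map (iota N H ν))) :
    UnitarilyEquivalent (E.inducedRep μ hμ)
      (Ind (isotropy N ν) (nuSigma ν e he σ) (μ.map (iota N H ν)) hμ') := by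
  let R := equivariantFunctionsEquiv ν e he σ L hL hfib hact hLc hp
  have hR : ∀ f q, (R f).1 q = f.1 (L q : G) := fun _ _ => rfl
  have hT : ∀ x f f', (inducedField (isotropy N ν) (nuSigma ν e he σ)).form (iota N H ν x)
      (R.symm f) (R.symm f') = E.formField.form x f f' := fun q f f' => by
    obtain ⟨f, rfl⟩ := R.surjective f
    obtain ⟨f', rfl⟩ := R.surjective f'
    rw [R.symm_apply_apply, R.symm_apply_apply, HermitianGBundle.form_eq_inner hmet, hR, hR]
    conv_lhs => rw [← hL q, iota_mk, inducedField_form_mk]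
  refine ⟨FormField.l2Equiv ⟨measurable_iota ν, rfl⟩ R.symm hT,
    FormField.l2Equiv_intertwines _ _ _ _ _ _ _ fun g ψ => ?_⟩
  obtain ⟨f, rfl⟩ := R.surjective ψ
  rw [R.symm_apply_apply, LinearEquiv.symm_apply_eq]
  refine Subtype.ext (funext fun q => ?_)
  -- Comparing at `gq` instead of `q` makes the cocycle `c = L(gq)⁻¹ g L(q)` appear.
  obtain ⟨q, rfl⟩ := (baseAction ν e he g).surjective q
  have h1 : baseAction ν e he g⁻¹ (baseAction ν e he g q) = q := by simp
  change (E.act g (baseAction ν e he g⁻¹ (baseAction ν e he g q),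
    f.1 (L (baseAction ν e he g⁻¹ (baseAction ν e he g q)) : G))).2 =
      f.1 (g⁻¹ * (L (baseAction ν e he g q) : G))
  rw [h1, hact, ← nuSigma_section]
  -- With this `c`, `g⁻¹ L(gq) = L(q) c⁻¹`, so equivariance gives `f(g⁻¹ L(gq)) = νσ(c) f(L(q))`.
  have h2 := f.2.2 (L q : G) (⟨_, section_inv_mul_mul_mem ν e he L hL g q⟩ : isotropy N ν)⁻¹
  rw [map_inv, inv_inv] at h2
  rw [← h2]
  simp [mul_assoc]

end InducedEquivalence

/-! ### Topology and Borel structure of the quotient. -/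

section QuotientTopology

variable {H : Type*} [Group H] [TopologicalSpace H] {S : Subgroup H} (L : H ⧸ S → H)
  (hL : ∀ q, ((L q : H) : H ⧸ S) = q) (hLc : Continuous L)

include hL hLc

theorem t2Space_quotient_of_section [T2Space H] : T2Space (H ⧸ S) :=
  T2Space.of_injective_continuous (LeftInverse.injective (g := QuotientGroup.mk) hL) hLc

/-- The σ-algebra on `H ⧸ S` is the quotient one, a priori larger than the Borel one. If `π⁻¹(s)` is
Borel in `H`, then so is `s = L⁻¹(π⁻¹(s))`, as `L` is continuous. -/
theorem borelSpace_quotient_of_section [MeasurableSpace H] [BorelSpace H] :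
    BorelSpace (H ⧸ S) := by
  refine ⟨le_antisymm (fun s hs => ?_) OpensMeasurableSpace.borel_le⟩
  have h1 : MeasurableSet ((↑) ⁻¹' s : Set H) := QuotientGroup.measurable_coe hs
  have h2 : Measurable[borel (H ⧸ S)] L :=
    @Continuous.measurable _ _ _ (borel (H ⧸ S))
      (@OpensMeasurableSpace.mk _ _ (_) le_rfl) _ _ _ _ hLc
  have h3 : L ⁻¹' ((↑) ⁻¹' s) = s := by
    ext q
    simp [hL]
  rw [← h3]
  exact h2 h1

end QuotientTopology

end Perception

end

/-! ### Assembly of the theorem. -/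

set_option maxHeartbeats 1000000 in
theorem theorem7p1
    {G EG EN EH EM K : Type*}
    -- the Lie group `G`
    [Group G] [TopologicalSpace G] [T2Space G] [SecondCountableTopology G]
    [NormedAddCommGroup EG] [NormedSpace ℝ EG] [FiniteDimensional ℝ EG] [ChartedSpace EG G]
    [IsTopologicalGroup G] [LieGroup 𝓘(ℝ, EG) ∞ G] [MeasurableSpace G] [BorelSpace G]
    -- Lie subgroups `N` (normal and abelian) and `H` such that `N × H → G` is a diffeomorphism
    (N H : Subgroup G) [N.Normal] [IsMulCommutative N]
    [NormedAddCommGroup EN] [NormedSpace ℝ EN] [FiniteDimensional ℝ EN] [ChartedSpace EN N]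
    [LieGroup 𝓘(ℝ, EN) ∞ N]
    [NormedAddCommGroup EH] [NormedSpace ℝ EH] [FiniteDimensional ℝ EH] [ChartedSpace EH H]
    [LieGroup 𝓘(ℝ, EH) ∞ H]
    (e : Diffeomorph (𝓘(ℝ, EN).prod 𝓘(ℝ, EH)) 𝓘(ℝ, EG) (N × H) G ∞)
    (he : ∀ (n : N) (h : H), e (n, h) = (n : G) * h)
    -- the character `ν`
    (ν : PontryaginDual N) (hν : ContMDiff 𝓘(ℝ, EN) (𝓡 1) ∞ ν)
    -- the quotient manifold `H/H_ν`, with the smooth structure for which `H → H/H_ν` is a submersion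
    [NormedAddCommGroup EM] [NormedSpace ℝ EM] [FiniteDimensional ℝ EM]
    [ChartedSpace EM (H ⧸ Perception.littleGroup N H ν)]
    [IsManifold 𝓘(ℝ, EM) ∞ (H ⧸ Perception.littleGroup N H ν)]
    (hπ : Manifold.IsSubmersion 𝓘(ℝ, EH) 𝓘(ℝ, EM) ∞
      (QuotientGroup.mk : H → H ⧸ Perception.littleGroup N H ν))
    -- the Hilbert space `K_Φ`, its subspace `H_σ`, and the representations `σ` and `Φ`
    [NormedAddCommGroup K] [InnerProductSpace ℂ K] [FiniteDimensional ℂ K] [CompleteSpace K]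
    [MeasurableSpace K] [BorelSpace K]
    (Hσ : Submodule ℂ K) (σ : Perception.littleGroup N H ν →* (Hσ ≃ₗᵢ[ℂ] Hσ))
    (Φ : H →* (K ≃L[ℂ] K))
    (hΦ : ContMDiff 𝓘(ℝ, EH) 𝓘(ℝ, K →L[ℂ] K) ∞ fun h => (Φ h : K →L[ℂ] K))
    (hσΦ : ∀ (k : Perception.littleGroup N H ν) (v : Hσ), Φ (k : H) (v : K) = (σ k v : K))
    -- the global section `L` and the invariant measure `μ`
    (L : H ⧸ Perception.littleGroup N H ν → H)
    (hL : ∀ q, ((L q : H) : H ⧸ Perception.littleGroup N H ν) = q)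
    (hL' : ContMDiff 𝓘(ℝ, EM) 𝓘(ℝ, EH) ∞ L)
    (μ : Measure (H ⧸ Perception.littleGroup N H ν)) [IsFiniteMeasureOnCompacts μ]
    [SMulInvariantMeasure H (H ⧸ Perception.littleGroup N H ν) μ] :
    ∃ (E : Perception.HermitianGBundle EG EM (Perception.baseAction ν e.toEquiv he) K)
      (EL : Perception.HermitianGBundle EG EM (Perception.baseAction ν e.toEquiv he) Hσ),
      let A : (H ⧸ Perception.littleGroup N H ν) × Hσ → (H ⧸ Perception.littleGroup N H ν) × K :=
        fun p => (p.1, Φ (L p.1) p.2)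
      let U := E.inducedRep μ (Perception.measurePreserving_baseAction ν e.toEquiv he μ)
      let UL := EL.inducedRep μ (Perception.measurePreserving_baseAction ν e.toEquiv he μ)
      let Indνσ := Perception.Ind (Perception.isotropy N ν) (Perception.nuSigma ν e.toEquiv he σ)
        (μ.map (Perception.iota N H ν))
        (Perception.measurePreserving_map_iota ν e.toEquiv he μ)
      -- the boosting bundle: bundle, metric and action
      (∀ q, EL.fiber q = ⊤) ∧
      (∀ q v w, EL.metric q v w = inner ℂ v w) ∧
      (∀ (n : N) (h y : H) (v : Hσ),
        EL.act ((n : G) * h) ((y : H ⧸ Perception.littleGroup N H ν), v) =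
          (((h * y : H) : H ⧸ Perception.littleGroup N H ν),
            ((ν (Perception.conjInv N ((h : G) * y) n) : Circle) : ℂ) •
              σ (Perception.wigner L hL h (y : H ⧸ Perception.littleGroup N H ν)) v)) ∧
      -- the perception bundle: bundle, metric and action
      E.total = range A ∧
      (∀ (x : H), ∀ v ∈ E.fiber (x : H ⧸ Perception.littleGroup N H ν),
        ∀ w ∈ E.fiber (x : H ⧸ Perception.littleGroup N H ν),
        E.metric (x : H ⧸ Perception.littleGroup N H ν) v w =
          inner ℂ v (ContinuousLinearMap.adjoint ((Φ x).symm : K →L[ℂ] K) ((Φ x).symm w))) ∧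
      (∀ (n : N) (h y : H), ∀ v ∈ E.fiber (y : H ⧸ Perception.littleGroup N H ν),
        E.act ((n : G) * h) ((y : H ⧸ Perception.littleGroup N H ν), v) =
          (((h * y : H) : H ⧸ Perception.littleGroup N H ν),
            ((ν (Perception.conjInv N ((h : G) * y) n) : Circle) : ℂ) • Φ h v)) ∧
      -- the map is an isomorphism of Hermitian `G`-bundles onto the perception bundle
      EL.IsIso E A ∧
      -- the three unitary representations and their equivalence
      Perception.IsUnitaryRepresentation U ∧ Perception.IsUnitaryRepresentation UL ∧
      Perception.IsUnitaryRepresentation Indνσ ∧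
      Perception.UnitarilyEquivalent Indνσ U ∧ Perception.UnitarilyEquivalent U UL ∧
      -- composition with the bundle isomorphism intertwines `UL` and `U`
      (∃ T : EL.L2 μ ≃ₗᵢ[ℂ] E.L2 μ, Perception.Intertwines UL U T ∧
        ∀ ψ : EL.PreL2 μ, ∃ φ : E.PreL2 μ,
          (∀ q, (q, Perception.HermitianGBundle.sec φ q) =
            A (q, Perception.HermitianGBundle.sec ψ q)) ∧
          T (Perception.HermitianGBundle.cls ψ) = Perception.HermitianGBundle.cls φ) ∧
      -- the boosting space is `L²(H/H_ν; μ) ⊗ H_σ`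
      ∃ T : (Lp ℂ 2 μ) ⊗[ℂ] Hσ ≃ₗᵢ[ℂ] EL.L2 μ,
        ∀ (f : Lp ℂ 2 μ) (v : Hσ), ∃ ψ : EL.PreL2 μ,
          (∀ᵐ q ∂μ, Perception.HermitianGBundle.sec ψ q = f q • v) ∧
          T (f ⊗ₜ[ℂ] v) = Perception.HermitianGBundle.cls ψ := by
  have hπ' := hπ.contMDiff
  have hLc : Continuous L := hL'.continuous
  have hpc : Continuous (Perception.projH e.toEquiv he) :=
    (Perception.contMDiff_projH e he).continuous
  -- These properties of `H/H_ν` serve the density of compactly supported sections; local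
  -- compactness of `G` gives the compact neighborhood of the identity used for strong continuity.
  have := Perception.t2Space_quotient_of_section L hL hLc
  have := Perception.borelSpace_quotient_of_section L hL hLc
  have : SecondCountableTopology H :=
    TopologicalSpace.Subtype.secondCountableTopology (H : Set G)
  have : SecondCountableTopology (H ⧸ Perception.littleGroup N H ν) :=
    QuotientGroup.isOpenQuotientMap_mk.isQuotientMap.secondCountableTopology
      QuotientGroup.isOpenMap_coe
  have : LocallyCompactSpace (H ⧸ Perception.littleGroup N H ν) :=
    haveI := FiniteDimensional.proper ℝ EM
    ChartedSpace.locallyCompactSpace EM _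
  have : LocallyCompactSpace G :=
    haveI := FiniteDimensional.proper ℝ EG
    ChartedSpace.locallyCompactSpace EG _
  let E := Perception.perceptionBundle e he ν hν hπ' σ Φ hΦ hσΦ L hL hL'
  let EL := Perception.boostingBundle e he ν hν hπ' σ Φ hΦ hσΦ L hL hL'
  have hiso : EL.IsIso E (Perception.boostMap ν Φ L Hσ) :=
    Perception.boostMap_isIso e he ν hν hπ' σ Φ hΦ hσΦ L hL hL'
  have hfib : ∀ q, EL.fiber q = ⊤ := fun _ => rfl
  have hmet : ∀ q v w, EL.metric q v w = inner ℂ v w := fun _ _ _ => rfl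
  have hμ := Perception.measurePreserving_baseAction ν e.toEquiv he μ
  obtain ⟨T, hT, hTA⟩ := hiso.exists_intertwines μ hμ
  have hUL : Perception.IsUnitaryRepresentation (EL.inducedRep μ hμ) :=
    Perception.HermitianGBundle.isUnitaryRepresentation_of_trivial hfib hmet μ hμ
  have hind := Perception.unitarilyEquivalent_ind ν e.toEquiv he σ L hL hfib hmet
    (fun _ _ _ => rfl) hLc hpc μ hμ (Perception.measurePreserving_map_iota ν e.toEquiv he μ)
  refine ⟨E, EL, hfib, hmet, fun n h y v => ?_,
    Perception.perceptionBundle_total e he ν hν hπ' σ Φ hΦ hσΦ L hL hL', fun x v hv w hw => ?_,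
    fun n h y v _ => ?_, hiso, hUL.of_equivalent ⟨T, hT⟩, hUL, hUL.of_equivalent hind,
    hind.symm.trans ⟨T, hT⟩, ⟨T.symm, hT.symm⟩, ⟨T, hT, hTA⟩,
    Perception.HermitianGBundle.exists_tensor_equiv hfib hmet μ⟩
  · refine Prod.ext (Perception.baseAction_mul_mk ν e.toEquiv he n h y) ?_
    change (Perception.boostPhase ν e.toEquiv he L ((n : G) * h) _ : ℂ) •
      σ (Perception.wigner L hL (Perception.projH e.toEquiv he ((n : G) * h)) _) v = _
    rw [Perception.boostPhase_mul_mk ν e.toEquiv he L hL, Perception.projH_mul_coe]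
  -- Moving the adjoint across turns the stated metric into `⟨Φ(x)⁻¹ v, Φ(x)⁻¹ w⟩`.
  · rw [ContinuousLinearMap.adjoint_inner_right]
    exact Perception.perceptionBundle_metric e he ν hν hπ' σ Φ hΦ hσΦ L hL hL' x hv hw
  · refine Prod.ext (Perception.baseAction_mul_mk ν e.toEquiv he n h y) ?_
    change (Perception.boostPhase ν e.toEquiv he L ((n : G) * h) _ : ℂ) •
      Φ (Perception.projH e.toEquiv he ((n : G) * h)) v = _
    rw [Perception.boostPhase_mul_mk ν e.toEquiv he L hL, Perception.projH_mul_coe]
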